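/- Let $X,Y,Z$ be finite sets with $X\cap Z=\emptyset$, $|X|=|Y|=n\ge 1$ and $|Z|=m$, and let $\alpha:Y\to X$ be a bijection. Let $\Omega_{n,m}$ be the abstract simplicial complex whose simplices are the sets $S\subseteq (X\cup Z)\times Y$ of squares such that any two distinct squares $(a,b),(a',b')\in S$ satisfy $a\neq a'$ and $b\neq b'$, and such that $S$ contains no cycle, i.e. no subset of the form $\{(\alpha(y_1),y_2),(\alpha(y_2),y_3),\ldots,(\alpha(y_l),y_1)\}$ with $1\le l\le n$ and $y_1,\dots,y_l\in Y$ distinct. (Up to isomorphism this complex depends only on $n$ and $m$.) If $m\ge n$, then the geometric realization of $\Omega_{n,m}$ is homotopy equivalent to a wedge of finitely many $(n-1)$-dimensional spheres, where the wedge of the empty family is a point. -/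

import Mathlib

/-! ### Chessboard complexes without cycles

A chessboard is a finite set `A` of squares `(a, b) : C × R`, where `C` is the type of columns and
`R` the type of rows. As in Mathlib, the empty simplex is not listed among the faces of a simplicial
complex. -/

section Chessboard

variable {C R : Type*}

/-- Non-taking rook configurations: distinct squares differ in both coordinates. -/
def IsNonTaking (S : Finset (C × R)) : Prop :=
  ∀ p ∈ S, ∀ q ∈ S, p ≠ q → p.1 ≠ q.1 ∧ p.2 ≠ q.2

/-- `S` contains a configuration `{(x₁, y₂), (x₂, y₃), …, (xₗ, y₁)}`, where `l ≥ 1`, the `yⱼ ∈ Y`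
are distinct and `xⱼ = α yⱼ`. Here `l = k + 1` and `j + 1` is addition modulo `k + 1`, so that
`k = 0` is a single square `(α y, y)`. -/
def HasCycle {X : Finset C} {Y : Finset R} (α : {y // y ∈ Y} ≃ {x // x ∈ X})
    (S : Finset (C × R)) : Prop :=
  ∃ (k : ℕ) (y : Fin (k + 1) → {y // y ∈ Y}), Function.Injective y ∧
    ∀ j, (((α (y j)) : C), ((y (j + 1)) : R)) ∈ S

/-- The simplices (the empty one included) of the cycle-free chessboard complex `Ω(X × Y, α)`. -/
def IsCycleFreeConfig (X : Finset C) (Y : Finset R) (α : {y // y ∈ Y} ≃ {x // x ∈ X})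
    (S : Finset (C × R)) : Prop :=
  S ⊆ X ×ˢ Y ∧ IsNonTaking S ∧ ¬ HasCycle α S

variable [DecidableEq C] [DecidableEq R]

/-- The generalized cycle-free chessboard complex `Ω(A, X × Y, α)`: all non-taking rook
configurations on `A` whose restriction to `X × Y` is a simplex of `Ω(X × Y, α)`. -/
def generalizedCycleFreeComplex (A : Finset (C × R)) (X : Finset C) (Y : Finset R)
    (α : {y // y ∈ Y} ≃ {x // x ∈ X}) : PreAbstractSimplicialComplex (C × R) where
  faces := {S | S.Nonempty ∧ S ⊆ A ∧ IsNonTaking S ∧ IsCycleFreeConfig X Y α (S ∩ X ×ˢ Y)}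
  isRelLowerSet_faces := by
    intro S hS
    refine ⟨hS.1, fun T hTS hT => ?_⟩
    obtain ⟨-, hA, hnt, -, hnt', hc⟩ := hS
    refine ⟨hT, hTS.trans hA, fun p hp q hq => hnt p (hTS hp) q (hTS hq),
      Finset.inter_subset_right, ?_, ?_⟩
    · intro p hp q hq
      exact hnt p (hTS (Finset.mem_inter.1 hp).1) q (hTS (Finset.mem_inter.1 hq).1)
    · rintro ⟨k, y, hy, h⟩
      exact hc ⟨k, y, hy, fun j => Finset.inter_subset_inter_right hTS (h j)⟩

/-- The complex `Ω^{Y,T}_{X,Z} = Ω((X ∪ Z) × (Y ∪ T), X × Y, α)`. With `|X| = |Y| = n`, `|Z| = m`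
and `T = ∅` this is the complex `Ω_{n,m}`. -/
def cycleFreeComplex (X Z : Finset C) (Y T : Finset R)
    (α : {y // y ∈ Y} ≃ {x // x ∈ X}) : PreAbstractSimplicialComplex (C × R) :=
  generalizedCycleFreeComplex ((X ∪ Z) ×ˢ (Y ∪ T)) X Y α

end Chessboard

/-! ### Geometric realization, spheres and wedges -/

/-- The geometric realization of a finite simplicial complex: the points of `V → ℝ` given by
barycentric coordinates supported on a face, with the subspace topology. -/
def geometricRealization {V : Type*} (K : PreAbstractSimplicialComplex V) : Set (V → ℝ) :=
  {w | ∃ s ∈ K.faces, (∀ v, 0 ≤ w v) ∧ (∀ v, v ∉ s → w v = 0) ∧ ∑ v ∈ s, w v = 1}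

/-- The unit sphere of `ℝ^(d+1)`, that is, the `d`-dimensional sphere. -/
abbrev UnitSphere (d : ℕ) : Type :=
  Metric.sphere (0 : EuclideanSpace ℝ (Fin (d + 1))) 1

/-- The base point `(1, 0, …, 0)`. -/
noncomputable def UnitSphere.base (d : ℕ) : UnitSphere d :=
  ⟨EuclideanSpace.single 0 1, by simp⟩

/-- The relation that identifies all base points `p i` with one added point. -/
inductive WedgeRel {ι : Type*} (E : ι → Type*) (p : ∀ i, E i) :
    Unit ⊕ (Σ i, E i) → Unit ⊕ (Σ i, E i) → Prop
  | glue (i : ι) : WedgeRel E p (Sum.inl ()) (Sum.inr ⟨i, p i⟩)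

/-- The wedge of a family of pointed spaces, with the quotient topology. The wedge of the empty
family is a point. -/
def Wedge {ι : Type*} (E : ι → Type*) (p : ∀ i, E i) : Type _ :=
  Quot (WedgeRel E p)

instance {ι : Type*} (E : ι → Type*) (p : ∀ i, E i) [∀ i, TopologicalSpace (E i)] :
    TopologicalSpace (Wedge E p) :=
  inferInstanceAs (TopologicalSpace (Quot (WedgeRel E p)))

/-- The wedge of `k` spheres of dimension `d`. -/
abbrev WedgeOfSpheres (k d : ℕ) : Type :=
  Wedge (fun _ : Fin k => UnitSphere d) (fun _ => UnitSphere.base d)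

/-!
The proof has a combinatorial and a topological half, joined by the following notion. A finite
complex, listed with its empty simplex, is *spherical* of size `n` (`IsSpherical`) if its simplices
have at most `n` vertices, and if some of its `n`-vertex simplices can be removed so that the rest
collapses. The collapse goes down to the void family, the empty simplex being matched with the last
vertex, so that no base case has to be singled out.

*The complex is spherical.* If the deletion of a vertex `v` is spherical of size `n + 1` and the link
of `v` is spherical of size `n`, the complex is spherical of size `n + 1`
(`IsSpherical.of_deletion_link`). Read a square in row `y` whose column is matched by `α` with row `w`
as an edge from `y` to `w`; a rook configuration is then a disjoint union of paths, with cycles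
excluded. The links that occur are the complexes of extensions of a fixed configuration `S` on a board
`A` of squares in the `u` rows that `S` leaves empty. Such a link is spherical as soon as each of
these rows has at least `2 * u - 1` available squares (`isSpherical_rookLink`). Two facts make the
induction work: a new rook costs every other row at most one available square (`eq_of_blocked`), and
among the available squares of a row there is one that can never take part in a cycle
(`exists_free_column`). Deleting the other squares in the row and the column of the latter square
leaves a cone. For the whole board, a row has `n + m - 1` available squares, which is at least
`2 * n - 1` because `n ≤ m`.

*Spherical complexes are wedges of spheres.* An elementary collapse is realized by an explicit
straight-line deformation, so that the subcomplex left after removing the facets is contractible. Its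
contraction extends to a homotopy of the whole complex
(`IsFacetSet.exists_homotopy_extension`), and hence collapsing the subcomplex to a point is a homotopy
equivalence (`nonempty_homotopyEquiv_of_isQuotientMap`). The quotient is the wedge of the removed
simplices modulo their boundaries, and an inverse stereographic projection identifies each of these
with a sphere (`IsFacetSet.nonempty_homotopyEquiv_wedge`).
-/

/-! ### Collapsible families and spherical families -/

section Collapse

variable {V : Type*} [DecidableEq V]

/-- A finite family of finite sets (a simplicial complex *with* its empty simplex) is collapsible if
it can be reduced to the void family by removing pairs `σ`, `insert u σ` where `insert u σ` is the
only simplex properly containing `σ`. The empty simplex takes part: it is matched with the last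
remaining vertex. -/
inductive Collapsible : Finset (Finset V) → Prop
  | void : Collapsible ∅
  | step (K : Finset (Finset V)) (σ : Finset V) (u : V) (hu : u ∉ σ) (hσ : σ ∈ K)
      (hτ : insert u σ ∈ K) (hfree : ∀ τ ∈ K, σ ⊆ τ → τ = σ ∨ τ = insert u σ)
      (h : Collapsible (K \ {σ, insert u σ})) : Collapsible K

/-- A family of sets with at most `n` elements each, which becomes collapsible after some of its
`n`-element members are removed. -/
def IsSpherical (K : Finset (Finset V)) (n : ℕ) : Prop :=
  (∀ s ∈ K, s.card ≤ n) ∧ ∃ F ⊆ K, (∀ f ∈ F, f.card = n) ∧ Collapsible (K \ F)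

theorem insert_injOn_notMem {v : V} {s t : Finset V} (hs : v ∉ s) (ht : v ∉ t)
    (h : insert v s = insert v t) : s = t := by
  rw [← Finset.erase_insert hs, h, Finset.erase_insert ht]

/-- Attaching a cone over a collapsible subfamily preserves collapsibility. -/
theorem Collapsible.union_cone {L M : Finset (Finset V)} {v : V} (hL : Collapsible L)
    (hM : Collapsible M) (hLM : L ⊆ M) (hv : ∀ s ∈ M, v ∉ s) :
    Collapsible (M ∪ L.image (insert v)) := by
  induction hL with
  | void => simpa using hM
  | step L σ u hu hσ hτ hfree h ih =>
    have huv : u ≠ v := by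
      rintro rfl
      exact hv _ (hLM hτ) (Finset.mem_insert_self _ _)
    have hvσ := hv _ (hLM hσ)
    have hvτ := hv _ (hLM hτ)
    refine .step _ (insert v σ) u (by simp [hu, huv])
      (Finset.mem_union_right _ (Finset.mem_image_of_mem _ hσ)) ?_ ?_ ?_
    · rw [Finset.insert_comm]
      exact Finset.mem_union_right _ (Finset.mem_image_of_mem _ hτ)
    · intro τ hτ' hsub
      rcases Finset.mem_union.1 hτ' with h1 | h1
      · exact absurd (hsub (Finset.mem_insert_self _ _)) (hv _ h1)
      · obtain ⟨ρ, hρ, rfl⟩ := Finset.mem_image.1 h1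
        have h2 : σ ⊆ ρ := (Finset.insert_subset_insert_iff hvσ).1 hsub
        rcases hfree ρ hρ h2 with rfl | rfl
        · exact Or.inl rfl
        · exact Or.inr (Finset.insert_comm _ _ _)
    · convert ih (Finset.sdiff_subset.trans hLM) using 1
      ext τ
      simp only [Finset.mem_sdiff, Finset.mem_union, Finset.mem_image, Finset.mem_insert,
        Finset.mem_singleton, not_or]
      constructor
      · rintro ⟨h1 | ⟨ρ, hρ, rfl⟩, h2, h3⟩
        · exact Or.inl h1
        · refine Or.inr ⟨ρ, ⟨hρ, ?_, ?_⟩, rfl⟩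
          · rintro rfl; exact h2 rfl
          · rintro rfl; exact h3 (Finset.insert_comm _ _ _)
      · rintro (h1 | ⟨ρ, ⟨hρ, h2, h3⟩, rfl⟩)
        · refine ⟨Or.inl h1, ?_, ?_⟩
          · rintro rfl; exact hv _ h1 (Finset.mem_insert_self _ _)
          · rintro rfl
            exact hv _ h1 (Finset.mem_insert_of_mem (Finset.mem_insert_self _ _))
        · refine ⟨Or.inr ⟨ρ, hρ, rfl⟩, ?_, ?_⟩
          · intro e; exact h2 (insert_injOn_notMem (hv _ (hLM hρ)) hvσ e)
          · intro e
            rw [Finset.insert_comm] at e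
            exact h3 (insert_injOn_notMem (hv _ (hLM hρ)) hvτ e)

theorem collapsible_cone (L : Finset (Finset V)) {v : V} (hv : ∀ s ∈ L, v ∉ s) :
    Collapsible (L ∪ L.image (insert v)) := by
  induction hn : L.card generalizing L with
  | zero =>
    rw [Finset.card_eq_zero] at hn
    subst hn
    simpa using Collapsible.void
  | succ n ih =>
    obtain ⟨τ, hτ⟩ := L.exists_maximal (Finset.card_pos.1 (by omega))
    have hmax : ∀ ρ ∈ L, τ ⊆ ρ → ρ = τ := fun ρ hρ h => (hτ.eq_of_le hρ h).symm
    have hτL := hτ.prop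
    have hvτ := hv _ hτL
    refine .step _ τ v hvτ (Finset.mem_union_left _ hτL)
      (Finset.mem_union_right _ (Finset.mem_image_of_mem _ hτL)) ?_ ?_
    · intro ρ hρ hsub
      rcases Finset.mem_union.1 hρ with h1 | h1
      · exact Or.inl (hmax ρ h1 hsub)
      · obtain ⟨ρ', hρ', rfl⟩ := Finset.mem_image.1 h1
        rw [hmax ρ' hρ' ((Finset.subset_insert_iff_of_notMem hvτ).1 hsub)]
        exact Or.inr rfl
    · convert ih (L.erase τ) (fun s hs => hv s (Finset.mem_of_mem_erase hs))
        (by rw [Finset.card_erase_of_mem hτL, hn]; rfl) using 1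
      ext ρ
      simp only [Finset.mem_sdiff, Finset.mem_union, Finset.mem_image, Finset.mem_insert,
        Finset.mem_singleton, not_or, Finset.mem_erase]
      constructor
      · rintro ⟨h1 | ⟨ρ, hρ, rfl⟩, h2, h3⟩
        · exact Or.inl ⟨h2, h1⟩
        · refine Or.inr ⟨ρ, ⟨?_, hρ⟩, rfl⟩
          rintro rfl; exact h3 rfl
      · rintro (⟨h2, h1⟩ | ⟨ρ, ⟨h2, hρ⟩, rfl⟩)
        · refine ⟨Or.inl h1, h2, ?_⟩
          rintro rfl; exact hv _ h1 (Finset.mem_insert_self _ _)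
        · refine ⟨Or.inr ⟨ρ, hρ, rfl⟩, ?_, ?_⟩
          · rintro rfl; exact hvτ (Finset.mem_insert_self _ _)
          · intro e; exact h2 (insert_injOn_notMem (hv _ hρ) hvτ e)

/-- If the deletion `M` and the link `L` of a vertex `v` are spherical, then so is the whole family
`M ∪ v * L`. No purity of `M` is needed: the `n`-element members removed from `L` are too small to
be among the `n + 1`-element members removed from `M`. -/
theorem IsSpherical.of_deletion_link {L M : Finset (Finset V)} {v : V} {n : ℕ}
    (hM : IsSpherical M (n + 1)) (hL : IsSpherical L n) (hLM : L ⊆ M) (hv : ∀ s ∈ M, v ∉ s) :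
    IsSpherical (M ∪ L.image (insert v)) (n + 1) := by
  obtain ⟨hMc, F, hFM, hFc, hF⟩ := hM
  obtain ⟨hLc, G, hGL, hGc, hG⟩ := hL
  refine ⟨?_, F ∪ G.image (insert v),
    Finset.union_subset_union hFM (Finset.image_subset_image hGL), ?_, ?_⟩
  · intro s hs
    rcases Finset.mem_union.1 hs with h | h
    · exact hMc s h
    · obtain ⟨t, ht, rfl⟩ := Finset.mem_image.1 h
      exact (Finset.card_insert_le _ _).trans (Nat.succ_le_succ (hLc t ht))
  · intro s hs
    rcases Finset.mem_union.1 hs with h | h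
    · exact hFc s h
    · obtain ⟨t, ht, rfl⟩ := Finset.mem_image.1 h
      rw [Finset.card_insert_of_notMem (hv _ (hLM (hGL ht))), hGc t ht]
  · have hsub : L \ G ⊆ M \ F := by
      intro s hs
      rw [Finset.mem_sdiff] at hs ⊢
      refine ⟨hLM hs.1, fun h => ?_⟩
      have h1 := hFc s h
      have h2 := hLc s hs.1
      omega
    convert hG.union_cone hF hsub
      (fun s hs => hv s (Finset.mem_sdiff.1 hs).1) using 1
    ext τ
    simp only [Finset.mem_sdiff, Finset.mem_union, Finset.mem_image, not_or]
    constructor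
    · rintro ⟨h1 | ⟨ρ, hρ, rfl⟩, h2, h3⟩
      · exact Or.inl ⟨h1, h2⟩
      · exact Or.inr ⟨ρ, ⟨hρ, fun h => h3 ⟨ρ, h, rfl⟩⟩, rfl⟩
    · rintro (⟨h1, h2⟩ | ⟨ρ, ⟨hρ, h2⟩, rfl⟩)
      · refine ⟨Or.inl h1, h2, ?_⟩
        rintro ⟨ρ, -, rfl⟩
        exact hv _ h1 (Finset.mem_insert_self _ _)
      · refine ⟨Or.inr ⟨ρ, hρ, rfl⟩, fun h => hv _ (hFM h) (Finset.mem_insert_self _ _), ?_⟩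
        rintro ⟨ρ', hρ', e⟩
        rw [insert_injOn_notMem (hv _ (hLM (hGL hρ'))) (hv _ (hLM hρ)) e] at hρ'
        exact h2 hρ'

end Collapse

/-! ### Rook configurations without cycles -/

section Rook

open Relation

variable {C R : Type*}

/-- The digraph of a set of squares. The relation `N c w` says that the column `c` is labelled by
the row `w`; a square `(c, u)` then is an edge from `u` to `w`. -/
def RookEdge (N : C → R → Prop) (S : Finset (C × R)) (u w : R) : Prop :=
  ∃ c, N c w ∧ (c, u) ∈ S

/-- Non-taking rook configurations whose digraph has no closed walk. -/
def IsAdmissible (N : C → R → Prop) (S : Finset (C × R)) : Prop :=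
  IsNonTaking S ∧ ∀ y, ¬ TransGen (RookEdge N S) y y

variable {N : C → R → Prop} {S T : Finset (C × R)}

theorem RookEdge.mono (h : S ⊆ T) {u w : R} (he : RookEdge N S u w) : RookEdge N T u w :=
  let ⟨c, hc, hm⟩ := he
  ⟨c, hc, h hm⟩

theorem IsAdmissible.mono (hT : IsAdmissible N T) (h : S ⊆ T) : IsAdmissible N S :=
  ⟨fun p hp q hq => hT.1 p (h hp) q (h hq),
    fun y hy => hT.2 y (TransGen.mono (fun _ _ => RookEdge.mono h) _ _ hy)⟩

theorem isAdmissible_empty : IsAdmissible N (∅ : Finset (C × R)) := by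
  refine ⟨fun p hp => by simp at hp, fun y hy => ?_⟩
  obtain ⟨z, ⟨c, -, hc⟩, -⟩ := TransGen.head'_iff.1 hy
  simp at hc

/-- A walk can be traced back in only one way, because every column carries at most one rook. -/
theorem eq_of_reflTransGen_of_no_pred (hN : ∀ c c' w, N c w → N c' w → c = c')
    (hS : IsNonTaking S) {b b' e : R} (h : ReflTransGen (RookEdge N S) b e)
    (h' : ReflTransGen (RookEdge N S) b' e) (hb : ∀ u, ¬ RookEdge N S u b)
    (hb' : ∀ u, ¬ RookEdge N S u b') : b = b' := by
  have hU : Relator.RightUnique (Function.swap (RookEdge N S)) := by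
    rintro w u u' ⟨c, hc, hm⟩ ⟨c', hc', hm'⟩
    obtain rfl := hN _ _ _ hc hc'
    by_contra hne
    exact (hS _ hm _ hm' fun e => hne (Prod.mk.inj e).2).1 rfl
  rcases ReflTransGen.total_of_right_unique hU (reflTransGen_swap.2 h)
    (reflTransGen_swap.2 h') with h1 | h1
  · rcases (reflTransGen_swap.1 h1).cases_tail with h2 | ⟨u, -, hu⟩
    · exact h2
    · exact absurd hu (hb u)
  · rcases (reflTransGen_swap.1 h1).cases_tail with h2 | ⟨u, -, hu⟩
    · exact h2.symm
    · exact absurd hu (hb' u)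

variable [DecidableEq C] [DecidableEq R]

theorem reflTransGen_insert {c : C} {y u w : R}
    (h : ReflTransGen (RookEdge N (insert (c, y) S)) u w) :
    ReflTransGen (RookEdge N S) u w ∨
      ∃ b, N c b ∧ ReflTransGen (RookEdge N S) u y ∧ ReflTransGen (RookEdge N S) b w := by
  induction h with
  | refl => exact Or.inl .refl
  | tail _ he ih =>
    obtain ⟨c', hc', hm⟩ := he
    rcases Finset.mem_insert.1 hm with h | h
    · obtain ⟨rfl, rfl⟩ := Prod.mk.inj h
      rcases ih with h1 | ⟨b, -, h2, -⟩
      · exact Or.inr ⟨_, hc', h1, .refl⟩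
      · exact Or.inr ⟨_, hc', h2, .refl⟩
    · rcases ih with h1 | ⟨b, hb, h2, h3⟩
      · exact Or.inl (h1.tail ⟨c', hc', h⟩)
      · exact Or.inr ⟨b, hb, h2, h3.tail ⟨c', hc', h⟩⟩

/-- Placing one more rook keeps a configuration admissible if and only if the rook attacks no other
one and the new edge does not close a walk. -/
theorem isAdmissible_insert_iff {c : C} {y : R} :
    IsAdmissible N (insert (c, y) S) ↔ IsAdmissible N S ∧
      (∀ q ∈ S, q ≠ (c, y) → q.1 ≠ c ∧ q.2 ≠ y) ∧
      ∀ b, N c b → ¬ ReflTransGen (RookEdge N S) b y := by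
  constructor
  · intro h
    refine ⟨h.mono (Finset.subset_insert _ _), fun q hq hne =>
      h.1 q (Finset.mem_insert_of_mem hq) _ (Finset.mem_insert_self _ _) hne, fun b hb hby => ?_⟩
    refine h.2 y (TransGen.head' ⟨c, hb, Finset.mem_insert_self _ _⟩ ?_)
    exact ReflTransGen.mono (fun _ _ => RookEdge.mono (Finset.subset_insert _ _)) _ _ hby
  · rintro ⟨h, hnt, hcyc⟩
    refine ⟨?_, fun u hu => ?_⟩
    · intro p hp q hq hne
      rcases Finset.mem_insert.1 hp with rfl | hp
      · rcases Finset.mem_insert.1 hq with rfl | hq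
        · exact absurd rfl hne
        · exact ⟨(hnt q hq hne.symm).1.symm, (hnt q hq hne.symm).2.symm⟩
      · rcases Finset.mem_insert.1 hq with rfl | hq
        · exact hnt p hp hne
        · exact h.1 p hp q hq hne
    · obtain ⟨w, huw, c', hc', hm⟩ := TransGen.tail'_iff.1 hu
      rcases Finset.mem_insert.1 hm with e | e
      · obtain ⟨rfl, rfl⟩ := Prod.mk.inj e
        rcases reflTransGen_insert huw with h1 | ⟨b, hb, -, h3⟩
        · exact hcyc _ hc' h1
        · exact hcyc _ hb h3
      · rcases reflTransGen_insert huw with h1 | ⟨b, hb, h2, h3⟩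
        · exact h.2 u (TransGen.tail' h1 ⟨c', hc', e⟩)
        · exact hcyc b hb ((h3.tail ⟨c', hc', e⟩).trans h2)

/-- A new rook makes at most one square of any other row inadmissible: either the square in its own
column, or the one that closes the walk ending in that row. -/
theorem eq_of_blocked (hN : ∀ c c' w, N c w → N c' w → c = c') {c c₁ c₂ : C}
    {y y' : R} (hy : y ≠ y') (hv : IsAdmissible N (insert (c, y) S))
    (h₁ : IsAdmissible N (insert (c₁, y') S)) (h₂ : IsAdmissible N (insert (c₂, y') S))
    (hb₁ : ¬ IsAdmissible N (insert (c₁, y') (insert (c, y) S)))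
    (hb₂ : ¬ IsAdmissible N (insert (c₂, y') (insert (c, y) S))) : c₁ = c₂ := by
  have key : ∀ a, IsAdmissible N (insert (a, y') S) →
      ¬ IsAdmissible N (insert (a, y') (insert (c, y) S)) → a = c ∨ a ≠ c ∧
        ∃ b, N a b ∧ ReflTransGen (RookEdge N (insert (c, y) S)) b y' ∧
          ∀ u, ¬ RookEdge N (insert (c, y) S) u b := by
    intro a ha hba
    by_cases hac : a = c
    · exact Or.inl hac
    refine Or.inr ⟨hac, ?_⟩
    have hba₀ := hba
    rw [isAdmissible_insert_iff] at hba
    push Not at hba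
    obtain ⟨-, hnt, -⟩ := isAdmissible_insert_iff.1 ha
    obtain ⟨b, hb, hby⟩ := hba hv (by
      intro q hq hne
      rcases Finset.mem_insert.1 hq with rfl | hq
      · exact ⟨Ne.symm hac, hy⟩
      · exact hnt q hq hne)
    refine ⟨b, hb, hby, ?_⟩
    rintro u ⟨a', ha', hm⟩
    obtain rfl := hN _ _ _ ha' hb
    rcases Finset.mem_insert.1 hm with e | e
    · exact hac (Prod.mk.inj e).1
    · by_cases hu : (a', u) = (a', y')
      · rw [hu] at e
        exact hba₀ (by rwa [Finset.insert_eq_of_mem (Finset.mem_insert_of_mem e)])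
      · exact (hnt _ e hu).1 rfl
  have mixed : ∀ a, a ≠ c → IsAdmissible N (insert (a, y') S) →
      IsAdmissible N (insert (c, y') S) →
      (∃ b, N a b ∧ ReflTransGen (RookEdge N (insert (c, y) S)) b y' ∧
          ∀ u, ¬ RookEdge N (insert (c, y) S) u b) → False := by
    rintro a - ha hc ⟨b, hb, hby, -⟩
    rcases reflTransGen_insert hby with h | ⟨b', hb', -, h⟩
    · exact (isAdmissible_insert_iff.1 ha).2.2 b hb h
    · exact (isAdmissible_insert_iff.1 hc).2.2 b' hb' h
  rcases key c₁ h₁ hb₁ with rfl | ⟨hne₁, hw₁⟩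
  · rcases key c₂ h₂ hb₂ with rfl | ⟨hne₂, hw₂⟩
    · rfl
    · exact (mixed _ hne₂ h₂ h₁ hw₂).elim
  · rcases key c₂ h₂ hb₂ with rfl | ⟨hne₂, hw₂⟩
    · exact (mixed _ hne₁ h₁ h₂ hw₁).elim
    · obtain ⟨b₁, hn₁, hr₁, hp₁⟩ := hw₁
      obtain ⟨b₂, hn₂, hr₂, hp₂⟩ := hw₂
      obtain rfl := eq_of_reflTransGen_of_no_pred hN hv.1 hr₁ hr₂ hp₁ hp₂
      exact hN _ _ _ hn₁ hn₂

/-- If a row `y` has at least as many admissible squares as there are empty rows, one of them starts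
no walk to an empty row: the walks from different admissible squares end in different rows, and none
ends in `y`. -/
theorem exists_free_column (hN : ∀ c c' w, N c w → N c' w → c = c') {U : Finset R}
    (hS : IsAdmissible N S) (hU : ∀ p ∈ S, p.2 ∉ U) {y : R} (hy : y ∈ U) {Q : Finset C}
    (hQ : ∀ c ∈ Q, IsAdmissible N (insert (c, y) S)) (hcard : U.card ≤ Q.card) :
    ∃ c ∈ Q, ∀ b, N c b → ∀ e ∈ U, ¬ ReflTransGen (RookEdge N S) b e := by
  by_contra! hcon
  have : Nonempty R := ⟨y⟩
  choose! b hb e he hr using hcon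
  have hmaps : ∀ c ∈ Q, e c ∈ U.erase y := by
    intro c hc
    refine Finset.mem_erase.2 ⟨fun h => ?_, he c hc⟩
    exact (isAdmissible_insert_iff.1 (hQ c hc)).2.2 _ (hb c hc) (h ▸ hr c hc)
  have hlt : (U.erase y).card < Q.card :=
    (Finset.card_lt_card (Finset.erase_ssubset hy)).trans_le hcard
  obtain ⟨c, hc, c', hc', hne, heq⟩ := Finset.exists_ne_map_eq_of_card_lt_of_maps_to hlt hmaps
  have hpred : ∀ c ∈ Q, ∀ u, ¬ RookEdge N S u (b c) := by
    rintro c hc u ⟨a, ha, hm⟩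
    obtain rfl := hN _ _ _ ha (hb c hc)
    have hu : (a, u) ≠ (a, y) := fun h => hU _ hm ((Prod.mk.inj h).2 ▸ hy)
    exact ((isAdmissible_insert_iff.1 (hQ a hc)).2.1 _ hm hu).1 rfl
  have hbb : b c = b c' := eq_of_reflTransGen_of_no_pred hN hS.1 (hr c hc)
    (heq ▸ hr c' hc') (hpred c hc) (hpred c' hc')
  exact hne (hN _ _ _ (hb c hc) (hbb ▸ hb c' hc'))

/-- A square that starts no walk to an empty row can be added to every admissible configuration
extending `S` that leaves its row and its column empty. -/
theorem IsAdmissible.insert_free {U : Finset R} {c : C} {y : R} (hy : y ∈ U)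
    (hfree : ∀ b, N c b → ∀ e ∈ U, ¬ ReflTransGen (RookEdge N S) b e)
    (hST : IsAdmissible N (S ∪ T)) (hT : ∀ p ∈ T, p.2 ∈ U) (hST' : ∀ p ∈ S ∪ T, p.1 ≠ c ∧ p.2 ≠ y) :
    IsAdmissible N (insert (c, y) (S ∪ T)) := by
  refine isAdmissible_insert_iff.2 ⟨hST, fun q hq _ => hST' q hq, fun b hb hby => ?_⟩
  have key : ∀ w, ReflTransGen (RookEdge N (S ∪ T)) b w → ReflTransGen (RookEdge N S) b w := by
    intro w hw
    induction hw with
    | refl => exact .refl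
    | tail _ he ih =>
      obtain ⟨a, ha, hm⟩ := he
      rcases Finset.mem_union.1 hm with h | h
      · exact ih.tail ⟨a, ha, h⟩
      · exact absurd ih (hfree b hb _ (hT _ h))
  exact hfree b hb y hy (key y hby)

end Rook

section RookLink

open Relation

variable {C R : Type*} [DecidableEq C] [DecidableEq R] {N : C → R → Prop}

open Classical in
/-- The link of the configuration `S` in the complex of admissible configurations, restricted to the
board `A`; the empty simplex is included. -/
noncomputable def rookLink (N : C → R → Prop) (S A : Finset (C × R)) :
    Finset (Finset (C × R)) :=
  A.powerset.filter fun T => IsAdmissible N (S ∪ T)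

open Classical in
/-- The squares of the board `A` in the row `y` on which a rook can be added to `S`. -/
noncomputable def openSquares (N : C → R → Prop) (S A : Finset (C × R)) (y : R) :
    Finset (C × R) :=
  A.filter fun p => p.2 = y ∧ IsAdmissible N (insert p S)

theorem mem_rookLink {S A T : Finset (C × R)} :
    T ∈ rookLink N S A ↔ T ⊆ A ∧ IsAdmissible N (S ∪ T) := by
  simp [rookLink]

theorem mem_openSquares {S A : Finset (C × R)} {y : R} {p : C × R} :
    p ∈ openSquares N S A y ↔ p ∈ A ∧ p.2 = y ∧ IsAdmissible N (insert p S) := by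
  simp [openSquares]

theorem card_le_of_mem_rookLink {S A T : Finset (C × R)} {U : Finset R}
    (hA : ∀ p ∈ A, p.2 ∈ U) (hT : T ∈ rookLink N S A) : T.card ≤ U.card := by
  obtain ⟨hTA, hT⟩ := mem_rookLink.1 hT
  refine Finset.card_le_card_of_injOn Prod.snd (fun p hp => hA p (hTA hp)) ?_
  intro p hp q hq h
  by_contra hne
  exact (hT.1 p (Finset.mem_union_right _ hp) q (Finset.mem_union_right _ hq) hne).2 h

theorem rookLink_erase_of_not_isAdmissible {S A : Finset (C × R)} {v : C × R}
    (hv : ¬ IsAdmissible N (insert v S)) : rookLink N S A = rookLink N S (A.erase v) := by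
  ext T
  rw [mem_rookLink, mem_rookLink, Finset.subset_erase]
  refine ⟨fun h => ⟨⟨h.1, fun hvT => hv (h.2.mono ?_)⟩, h.2⟩, fun h => ⟨h.1.1, h.2⟩⟩
  exact Finset.insert_subset (Finset.mem_union_right _ hvT) Finset.subset_union_left

/-- Decomposition into the deletion of the vertex `v` and the cone over its link. -/
theorem rookLink_eq_union {S A : Finset (C × R)} {v : C × R} (hvA : v ∈ A) :
    rookLink N S A = rookLink N S (A.erase v) ∪
      (rookLink N (insert v S) (A.filter fun p => p.2 ≠ v.2)).image (insert v) := by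
  ext T
  simp only [Finset.mem_union, Finset.mem_image, mem_rookLink]
  constructor
  · rintro ⟨hTA, hT⟩
    by_cases hvT : v ∈ T
    · refine Or.inr ⟨T.erase v, ⟨fun p hp => ?_, ?_⟩, Finset.insert_erase hvT⟩
      · obtain ⟨hpv, hpT⟩ := Finset.mem_erase.1 hp
        exact Finset.mem_filter.2 ⟨hTA hpT, (hT.1 p (Finset.mem_union_right _ hpT) v
          (Finset.mem_union_right _ hvT) hpv).2⟩
      · rwa [Finset.insert_union, ← Finset.union_insert, Finset.insert_erase hvT]
    · exact Or.inl ⟨Finset.subset_erase.2 ⟨hTA, hvT⟩, hT⟩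
  · rintro (⟨hTA, hT⟩ | ⟨T, ⟨hTA, hT⟩, rfl⟩)
    · exact ⟨hTA.trans (Finset.erase_subset _ _), hT⟩
    · refine ⟨Finset.insert_subset hvA (hTA.trans (Finset.filter_subset _ _)), ?_⟩
      rwa [Finset.union_insert, ← Finset.insert_union]

theorem card_openSquares_le (hN : ∀ c c' w, N c w → N c' w → c = c') {S A : Finset (C × R)}
    {v : C × R} (hv : IsAdmissible N (insert v S)) {y : R} (hy : y ≠ v.2) :
    (openSquares N S A y).card ≤
      (openSquares N (insert v S) (A.filter fun p => p.2 ≠ v.2) y).card + 1 := by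
  have h1 : (openSquares N S A y \
      openSquares N (insert v S) (A.filter fun p => p.2 ≠ v.2) y).card ≤ 1 := by
    refine Finset.card_le_one.2 ?_
    have key : ∀ p ∈ openSquares N S A y \
        openSquares N (insert v S) (A.filter fun p => p.2 ≠ v.2) y,
        p = (p.1, y) ∧ IsAdmissible N (insert (p.1, y) S) ∧
          ¬ IsAdmissible N (insert (p.1, y) (insert (v.1, v.2) S)) := by
      rintro ⟨c, y'⟩ hp
      obtain ⟨h, h'⟩ := Finset.mem_sdiff.1 hp
      obtain ⟨hA, rfl, h2⟩ := mem_openSquares.1 h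
      refine ⟨rfl, h2, fun h3 => h' (mem_openSquares.2 ⟨?_, rfl, h3⟩)⟩
      exact Finset.mem_filter.2 ⟨hA, hy⟩
    intro p hp q hq
    obtain ⟨ep, hp1, hp2⟩ := key p hp
    obtain ⟨eq, hq1, hq2⟩ := key q hq
    rw [ep, eq, eq_of_blocked hN hy.symm hv hp1 hq1 hp2 hq2]
  have h2 := Finset.card_le_card_sdiff_add_card (s := openSquares N S A y)
    (t := openSquares N (insert v S) (A.filter fun p => p.2 ≠ v.2) y)
  omega

/-- If each of the `u` empty rows has at least `2 * u - 1` squares on which a rook can be added to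
`S`, then the link of `S` is spherical of dimension `u - 1`.

Choose a square `(c₁, y₁)` that starts no walk to an empty row. The other squares in column `c₁`,
and then the other squares in row `y₁`, are deleted one at a time; passing from `S` to `insert v S`
costs every other row at most one square, so that all the links are spherical by induction on `u`.
What remains is a cone with apex `(c₁, y₁)`. -/
theorem isSpherical_rookLink (hN : ∀ c c' w, N c w → N c' w → c = c') (u : ℕ) :
    ∀ (S A : Finset (C × R)) (U : Finset R), IsAdmissible N S → (∀ p ∈ S, p.2 ∉ U) →
      (∀ p ∈ A, p.2 ∈ U) → U.card = u → (∀ y ∈ U, 2 * u ≤ (openSquares N S A y).card + 1) →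
      IsSpherical (rookLink N S A) u := by
  induction u with
  | zero =>
    intro S A U hS _ hA hU _
    rw [Finset.card_eq_zero] at hU
    subst hU
    have hA' : A = ∅ := Finset.eq_empty_of_forall_notMem fun p hp => by simpa using hA p hp
    have hL : rookLink N S A = {∅} := by
      ext T
      rw [mem_rookLink, hA', Finset.subset_empty, Finset.mem_singleton]
      exact ⟨fun h => h.1, fun h => ⟨h, by rwa [h, Finset.union_empty]⟩⟩
    rw [hL]
    exact ⟨by simp, {∅}, subset_rfl, by simp, by simpa using Collapsible.void⟩
  | succ u ih =>
    intro S A U hS hSU hA hU hopen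
    obtain ⟨y₁, hy₁⟩ := Finset.card_pos.1 (by omega : 0 < U.card)
    obtain ⟨c₁, hc₁, hfree⟩ := exists_free_column hN hS hSU hy₁
      (Q := (openSquares N S A y₁).image Prod.fst) (by
        intro c hc
        obtain ⟨⟨c, y⟩, hp, rfl⟩ := Finset.mem_image.1 hc
        obtain ⟨-, rfl, h⟩ := mem_openSquares.1 hp
        exact h) (by
        rw [Finset.card_image_of_injOn]
        · have := hopen y₁ hy₁
          omega
        · rintro ⟨c, y⟩ hp ⟨c', y'⟩ hq rfl
          obtain ⟨-, rfl, -⟩ := mem_openSquares.1 hp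
          obtain ⟨-, h, -⟩ := mem_openSquares.1 hq
          exact Prod.ext rfl h.symm)
    obtain ⟨⟨_, _⟩, hp, rfl⟩ := Finset.mem_image.1 hc₁
    obtain ⟨hv₁A, rfl, hv₁⟩ := mem_openSquares.1 hp
    clear hp hc₁
    rename_i c₁ y₁
    -- Column `c₁` has to be emptied before row `y₁`, as its links still need squares in row `y₁`.
    have claim : ∀ A' ⊆ A, (c₁, y₁) ∈ A' →
        (∀ y ∈ U, y ≠ y₁ → 2 * u ≤ ((openSquares N S A' y).filter fun p => p.1 ≠ c₁).card) →
        ((∃ p ∈ A', p ≠ (c₁, y₁) ∧ p.1 = c₁) → 2 * u ≤ (openSquares N S A' y₁).card) →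
        IsSpherical (rookLink N S A') (u + 1) := by
      intro A'
      induction A' using Finset.strongInduction with
      | H A' ihA =>
      intro hA'A hv₁A' hrows hcol
      -- Deletion of `v`, given that the links of `v` have enough squares in row `y₁`.
      have delete : ∀ v ∈ A', v ≠ (c₁, y₁) → (v.1 = c₁ ∨ v.2 = y₁) →
          (v.2 ≠ y₁ → 2 * u ≤ (openSquares N S A' y₁).card) →
          ((∃ p ∈ A'.erase v, p ≠ (c₁, y₁) ∧ p.1 = c₁) →
            2 * u ≤ (openSquares N S (A'.erase v) y₁).card) →
          IsSpherical (rookLink N S A') (u + 1) := by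
        intro v hvA' hne hbad hrow hcol'
        have hdel : IsSpherical (rookLink N S (A'.erase v)) (u + 1) := by
          refine ihA _ (Finset.erase_ssubset hvA') ((Finset.erase_subset _ _).trans hA'A)
            (Finset.mem_erase.2 ⟨hne.symm, hv₁A'⟩) ?_ hcol'
          intro y hy hyne
          refine (hrows y hy hyne).trans (Finset.card_le_card ?_)
          intro p hp
          simp only [Finset.mem_filter, mem_openSquares, Finset.mem_erase] at hp ⊢
          refine ⟨⟨⟨?_, hp.1.1⟩, hp.1.2⟩, hp.2⟩
          rintro rfl
          rcases hbad with h | h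
          · exact hp.2 h
          · exact hyne (hp.1.2.1.symm.trans h)
        by_cases hv : IsAdmissible N (insert v S)
        · rw [rookLink_eq_union hvA']
          refine hdel.of_deletion_link ?_ ?_ ?_
          · refine ih _ _ (U.erase v.2) hv ?_ ?_ ?_ ?_
            · intro p hp h
              rcases Finset.mem_insert.1 hp with rfl | hp
              · simp at h
              · exact hSU p hp (Finset.mem_of_mem_erase h)
            · intro p hp
              obtain ⟨h1, h2⟩ := Finset.mem_filter.1 hp
              exact Finset.mem_erase.2 ⟨h2, hA p (hA'A h1)⟩
            · rw [Finset.card_erase_of_mem (hA v (hA'A hvA')), hU]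
              rfl
            · intro y hy
              obtain ⟨hyv, hyU⟩ := Finset.mem_erase.1 hy
              refine le_trans ?_ (card_openSquares_le hN hv hyv)
              by_cases hyy : y = y₁
              · subst hyy
                exact hrow hyv.symm
              · exact (hrows y hyU hyy).trans (Finset.card_le_card (Finset.filter_subset _ _))
          · intro T hT
            obtain ⟨h1, h2⟩ := mem_rookLink.1 hT
            refine mem_rookLink.2 ⟨fun p hp => ?_,
              h2.mono (Finset.union_subset_union_left (Finset.subset_insert _ _))⟩
            obtain ⟨h3, h4⟩ := Finset.mem_filter.1 (h1 hp)
            refine Finset.mem_erase.2 ⟨?_, h3⟩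
            rintro rfl
            exact h4 rfl
          · intro T hT hvT
            exact absurd ((mem_rookLink.1 hT).1 hvT) (Finset.notMem_erase _ _)
        · rwa [rookLink_erase_of_not_isAdmissible hv]
      by_cases hc : ∃ v ∈ A', v ≠ (c₁, y₁) ∧ v.1 = c₁
      · obtain ⟨v, hvA', hne, hvc⟩ := hc
        have hvy : v.2 ≠ y₁ := fun h => hne (Prod.ext hvc h)
        refine delete v hvA' hne (Or.inl hvc) (fun _ => hcol ⟨v, hvA', hne, hvc⟩) fun _ => ?_
        refine (hcol ⟨v, hvA', hne, hvc⟩).trans (Finset.card_le_card ?_)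
        intro p hp
        simp only [mem_openSquares, Finset.mem_erase] at hp ⊢
        refine ⟨⟨?_, hp.1⟩, hp.2⟩
        rintro rfl
        exact hvy hp.2.1
      by_cases hr : ∃ v ∈ A', v ≠ (c₁, y₁) ∧ v.2 = y₁
      · obtain ⟨v, hvA', hne, hvy⟩ := hr
        refine delete v hvA' hne (Or.inr hvy) (fun h => absurd hvy h) ?_
        rintro ⟨p, hp, hpne, hpc⟩
        exact absurd ⟨p, Finset.mem_of_mem_erase hp, hpne, hpc⟩ hc
      push Not at hc hr
      refine ⟨fun T hT => hU ▸ card_le_of_mem_rookLink (fun p hp => hA p (hA'A hp)) hT,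
        ∅, Finset.empty_subset _, by simp, ?_⟩
      rw [Finset.sdiff_empty]
      convert collapsible_cone (rookLink N S (A'.erase (c₁, y₁))) (v := (c₁, y₁)) ?_ using 1
      · ext T
        simp only [Finset.mem_union, Finset.mem_image, mem_rookLink]
        constructor
        · rintro ⟨h1, h2⟩
          by_cases hvT : (c₁, y₁) ∈ T
          · refine Or.inr ⟨T.erase (c₁, y₁), ⟨Finset.erase_subset_erase _ h1, ?_⟩,
              Finset.insert_erase hvT⟩
            exact h2.mono (Finset.union_subset_union_right (Finset.erase_subset _ _))
          · exact Or.inl ⟨Finset.subset_erase.2 ⟨h1, hvT⟩, h2⟩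
        · rintro (⟨h1, h2⟩ | ⟨T, ⟨h1, h2⟩, rfl⟩)
          · exact ⟨h1.trans (Finset.erase_subset _ _), h2⟩
          · have hTA' := h1.trans (Finset.erase_subset _ _)
            refine ⟨Finset.insert_subset hv₁A' hTA', ?_⟩
            rw [Finset.union_insert]
            refine IsAdmissible.insert_free hy₁ hfree h2 (fun p hp => hA p (hA'A (hTA' hp))) ?_
            intro p hp
            rcases Finset.mem_union.1 hp with h | h
            · refine (isAdmissible_insert_iff.1 hv₁).2.1 p h ?_
              rintro rfl
              exact hSU _ h hy₁
            · have hne : p ≠ (c₁, y₁) := (Finset.mem_erase.1 (h1 h)).1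
              exact ⟨hc p (hTA' h) hne, hr p (hTA' h) hne⟩
      · intro T hT hvT
        exact absurd ((mem_rookLink.1 hT).1 hvT) (Finset.notMem_erase _ _)
    refine claim A subset_rfl hv₁A ?_ fun _ => ?_
    · intro y hy _
      have h1 : ((openSquares N S A y).filter fun p => ¬ p.1 ≠ c₁).card ≤ 1 := by
        refine Finset.card_le_one.2 ?_
        rintro ⟨c, z⟩ hp ⟨c', z'⟩ hq
        simp only [Finset.mem_filter, mem_openSquares, not_not] at hp hq
        exact Prod.ext (hp.2.trans hq.2.symm) (hp.1.2.1.trans hq.1.2.1.symm)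
      have h2 := Finset.card_filter_add_card_filter_not (s := openSquares N S A y)
        (fun p => p.1 ≠ c₁)
      have h3 := hopen y hy
      omega
    · have := hopen y₁ hy₁
      omega

end RookLink

section CycleFree

open Relation

theorem exists_walk_of_transGen {β : Type*} {r : β → β → Prop} {a b : β} (h : TransGen r a b) :
    ∃ (l : ℕ) (g : ℕ → β), g 0 = b ∧ g (l + 1) = a ∧ ∀ i ≤ l, r (g (i + 1)) (g i) := by
  induction h using TransGen.head_induction_on with
  | @single a hab =>
    refine ⟨0, fun i => if i = 0 then b else a, rfl, rfl, ?_⟩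
    intro i hi
    obtain rfl : i = 0 := by omega
    exact hab
  | @head a c hac _ ih =>
    obtain ⟨l, g, h0, h1, hg⟩ := ih
    refine ⟨l + 1, fun i => if i ≤ l + 1 then g i else a, by simpa using h0, by simp, ?_⟩
    intro i hi
    rcases Nat.lt_or_eq_of_le hi with h | rfl
    · simpa [show i + 1 ≤ l + 1 by omega, hi] using hg i (by omega)
    · simpa [h1] using hac

/-- A shortest closed walk visits no vertex twice. -/
theorem exists_injective_cycle_of_transGen {β : Type*} {r : β → β → Prop} {a : β}
    (h : TransGen r a a) :
    ∃ (k : ℕ) (y : Fin (k + 1) → β), Function.Injective y ∧ ∀ j, r (y (j + 1)) (y j) := by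
  classical
  have hex : ∃ l, ∃ g : ℕ → β, g (l + 1) = g 0 ∧ ∀ i ≤ l, r (g (i + 1)) (g i) := by
    obtain ⟨l, g, h0, h1, hg⟩ := exists_walk_of_transGen h
    exact ⟨l, g, h1.trans h0.symm, hg⟩
  obtain ⟨g, hclosed, hg⟩ := Nat.find_spec hex
  have hmin := fun l => Nat.find_min (H := hex) (m := l)
  set k := Nat.find hex
  have hinj : ∀ i j, i < j → j ≤ k → g i ≠ g j := by
    intro i j hij hj heq
    refine hmin (j - i - 1) (by omega) ⟨fun t => g (i + t), ?_, fun t ht => ?_⟩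
    · change g (i + (j - i - 1 + 1)) = g (i + 0)
      rw [show i + (j - i - 1 + 1) = j by omega, ← heq, Nat.add_zero]
    · exact hg (i + t) (by omega)
  refine ⟨k, fun j => g j, ?_, ?_⟩
  · intro i j hij
    rcases lt_trichotomy (i : ℕ) (j : ℕ) with h | h | h
    · exact absurd hij (hinj _ _ h (by omega))
    · exact Fin.ext h
    · exact absurd hij.symm (hinj _ _ h (by omega))
  · intro j
    have h := hg j (by omega)
    by_cases hj : (j : ℕ) = k
    · have h0 : j + 1 = 0 := by
        have : j = Fin.last k := Fin.ext hj
        rw [this, Fin.last_add_one]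
      rw [hj, hclosed] at h
      simpa [h0, hj] using h
    · have h1 : ((j + 1 : Fin (k + 1)) : ℕ) = j + 1 :=
        Fin.val_add_one_of_lt (Fin.lt_last_iff_ne_last.2 fun e => hj (by simp [e]))
      simpa [h1] using h

variable {C R : Type*}

/-- The column `c` is labelled by the row `w` if it is the column matched with `w` by `α`. -/
def columnLabel {X : Finset C} {Y : Finset R} (α : {y // y ∈ Y} ≃ {x // x ∈ X}) (c : C) (w : R) :
    Prop :=
  ∃ h : w ∈ Y, (α ⟨w, h⟩ : C) = c

variable {X : Finset C} {Y : Finset R} {α : {y // y ∈ Y} ≃ {x // x ∈ X}}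

open Fin.NatCast Fin.CommRing in
theorem hasCycle_iff_transGen {S : Finset (C × R)} :
    HasCycle α S ↔ ∃ y, TransGen (RookEdge (columnLabel α) S) y y := by
  constructor
  · rintro ⟨k, y, -, hy⟩
    have hedge : ∀ j, RookEdge (columnLabel α) S (y (j + 1)) (y j) := fun j =>
      ⟨_, ⟨(y j).2, rfl⟩, hy j⟩
    have hwalk : ∀ i : ℕ, TransGen (RookEdge (columnLabel α) S)
        (y ((i + 1 : ℕ) : Fin (k + 1))) (y 0) := by
      intro i
      induction i with
      | zero => simpa using TransGen.single (hedge 0)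
      | succ i ih =>
        refine TransGen.head ?_ ih
        have := hedge ((i + 1 : ℕ) : Fin (k + 1))
        rwa [← Nat.cast_succ] at this
    refine ⟨y 0, ?_⟩
    have := hwalk k
    rwa [Fin.natCast_self] at this
  · rintro ⟨z, hz⟩
    obtain ⟨k, y, hinj, hy⟩ := exists_injective_cycle_of_transGen hz
    have hmem : ∀ j, y j ∈ Y := fun j => by
      obtain ⟨c, ⟨h, -⟩, -⟩ := hy j
      exact h
    refine ⟨k, fun j => ⟨y j, hmem j⟩, fun i j h => hinj (congrArg Subtype.val h), fun j => ?_⟩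
    obtain ⟨c, ⟨h, hc⟩, hm⟩ := hy j
    rw [← hc] at hm
    exact hm

variable [DecidableEq C] [DecidableEq R]

theorem hasCycle_inter_iff {S : Finset (C × R)} :
    HasCycle α (S ∩ X ×ˢ Y) ↔ HasCycle α S := by
  refine ⟨fun ⟨k, y, hy, h⟩ => ⟨k, y, hy, fun j => Finset.inter_subset_left (h j)⟩,
    fun ⟨k, y, hy, h⟩ => ⟨k, y, hy, fun j => Finset.mem_inter.2 ⟨h j, ?_⟩⟩⟩
  exact Finset.mk_mem_product (α (y j)).2 (y (j + 1)).2

theorem mem_faces_cycleFreeComplex {Z : Finset C} {S : Finset (C × R)} :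
    S ∈ (cycleFreeComplex X Z Y ∅ α).faces ↔
      S.Nonempty ∧ S ∈ rookLink (columnLabel α) ∅ ((X ∪ Z) ×ˢ Y) := by
  have hdef : S ∈ (cycleFreeComplex X Z Y ∅ α).faces ↔ S.Nonempty ∧
      S ⊆ (X ∪ Z) ×ˢ (Y ∪ ∅) ∧ IsNonTaking S ∧ IsCycleFreeConfig X Y α (S ∩ X ×ˢ Y) := Iff.rfl
  rw [hdef, Finset.union_empty, mem_rookLink, Finset.empty_union]
  refine and_congr_right fun _ => and_congr_right fun _ => and_congr_right fun hnt => ?_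
  rw [← not_exists, ← hasCycle_iff_transGen, ← hasCycle_inter_iff (S := S)]
  exact ⟨fun h => h.2.2, fun h => ⟨Finset.inter_subset_right, fun p hp q hq =>
    hnt p (Finset.mem_inter.1 hp).1 q (Finset.mem_inter.1 hq).1, h⟩⟩

theorem isSpherical_cycleFree {Z : Finset C} (hXZ : Disjoint X Z) (hXY : X.card = Y.card)
    (hYZ : Y.card ≤ Z.card) :
    IsSpherical (rookLink (columnLabel α) ∅ ((X ∪ Z) ×ˢ Y)) Y.card := by
  refine isSpherical_rookLink (fun c c' w ⟨_, h⟩ ⟨_, h'⟩ => h.symm.trans h') _ _ _ Y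
    isAdmissible_empty (by simp) (fun p hp => (Finset.mem_product.1 hp).2) rfl fun y hy => ?_
  have hsub : ((X ∪ Z).erase (α ⟨y, hy⟩)).image (fun c => (c, y)) ⊆
      openSquares (columnLabel α) ∅ ((X ∪ Z) ×ˢ Y) y := by
    intro p hp
    obtain ⟨c, hc, rfl⟩ := Finset.mem_image.1 hp
    obtain ⟨hne, hc⟩ := Finset.mem_erase.1 hc
    refine mem_openSquares.2 ⟨Finset.mk_mem_product hc hy, rfl,
      isAdmissible_insert_iff.2 ⟨isAdmissible_empty, by simp, ?_⟩⟩
    rintro b ⟨hb, rfl⟩ hby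
    rcases hby.cases_head with rfl | ⟨d, ⟨a, -, ha⟩, -⟩
    · exact hne rfl
    · simp at ha
  have h1 := Finset.card_le_card hsub
  rw [Finset.card_image_of_injective _ (Prod.mk_left_injective y),
    Finset.card_erase_of_mem (Finset.mem_union_left _ (α ⟨y, hy⟩).2),
    Finset.card_union_of_disjoint hXZ] at h1
  omega

end CycleFree

/-! ### Realizations and elementary collapses -/

section Realization

variable {V : Type*}

/-- The geometric realization of a family of finite sets; an empty member contributes no point. -/
def realize (K : Set (Finset V)) : Set (V → ℝ) :=
  {w | ∃ s ∈ K, (∀ v, 0 ≤ w v) ∧ (∀ v, v ∉ s → w v = 0) ∧ ∑ v ∈ s, w v = 1}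

theorem realize_mono {K L : Set (Finset V)} (h : K ⊆ L) : realize K ⊆ realize L :=
  fun _ ⟨s, hs, hw⟩ => ⟨s, h hs, hw⟩

theorem realize_inter_nonempty (K : Set (Finset V)) :
    realize {s | s.Nonempty ∧ s ∈ K} = realize K := by
  refine subset_antisymm (realize_mono fun s hs => hs.2) ?_
  rintro w ⟨s, hs, h0, h1, h2⟩
  refine ⟨s, ⟨Finset.nonempty_iff_ne_empty.2 ?_, hs⟩, h0, h1, h2⟩
  rintro rfl
  simp at h2

theorem isCompact_realize (K : Finset (Finset V)) : IsCompact (realize (K : Set (Finset V))) := by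
  have h : realize (K : Set (Finset V)) = ⋃ s ∈ K,
      {w : V → ℝ | (∀ v, 0 ≤ w v) ∧ (∀ v, v ∉ s → w v = 0) ∧ ∑ v ∈ s, w v = 1} := by
    ext w
    simp only [realize, Set.mem_ofPred_eq, Set.mem_iUnion, exists_prop, Finset.mem_coe]
  rw [h]
  refine K.isCompact_biUnion fun s _ => ?_
  have hcube : IsCompact (Set.pi Set.univ fun _ : V => Set.Icc (0 : ℝ) 1) :=
    isCompact_univ_pi fun _ => isCompact_Icc
  refine hcube.of_isClosed_subset ?_ ?_
  · have e : {w : V → ℝ | (∀ v, 0 ≤ w v) ∧ (∀ v, v ∉ s → w v = 0) ∧ ∑ v ∈ s, w v = 1} =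
        (⋂ v, {w | 0 ≤ w v}) ∩ (⋂ v, ⋂ (_ : v ∉ s), {w | w v = 0}) ∩
          {w | ∑ v ∈ s, w v = 1} := by
      ext w
      simp [and_assoc]
    rw [e]
    refine ((isClosed_iInter fun v => isClosed_le continuous_const (continuous_apply v)).inter
      (isClosed_iInter fun v => isClosed_iInter fun _ =>
        isClosed_eq (continuous_apply v) continuous_const)).inter
      (isClosed_eq (by fun_prop) continuous_const)
  · rintro w ⟨h0, h1, h2⟩ v -
    refine ⟨h0 v, ?_⟩
    by_cases hv : v ∈ s
    · rw [← h2]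
      exact Finset.single_le_sum (fun u _ => h0 u) hv
    · rw [h1 v hv]
      exact zero_le_one

/-- A point supported on a simplex `s`, with a vanishing coordinate at `v`, is supported on
`s.erase v`. -/
theorem sum_erase_eq_one [DecidableEq V] {s : Finset V} {w : V → ℝ} {v : V}
    (h1 : ∀ u, u ∉ s → w u = 0) (h2 : ∑ u ∈ s, w u = 1) (hv : w v = 0) :
    (∀ u, u ∉ s.erase v → w u = 0) ∧ ∑ u ∈ s.erase v, w u = 1 := by
  refine ⟨fun u hu => ?_, by rw [Finset.sum_erase _ hv, h2]⟩
  by_cases huv : u = v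
  · rw [huv, hv]
  · exact h1 u fun h => hu (Finset.mem_erase.2 ⟨huv, h⟩)

/-- A homotopy equivalence from a strong deformation, given as a homotopy of the ambient space. -/
theorem nonempty_homotopyEquiv_of_deformation {X : Type*} [TopologicalSpace X] {A B : Set X}
    (hAB : A ⊆ B) (φ : unitInterval × X → X) (hφ : Continuous φ) (h0 : ∀ x ∈ B, φ (0, x) = x)
    (hB : ∀ t, ∀ x ∈ B, φ (t, x) ∈ B) (h1 : ∀ x ∈ B, φ (1, x) ∈ A)
    (hA : ∀ t, ∀ x ∈ A, φ (t, x) = x) : Nonempty (ContinuousMap.HomotopyEquiv B A) := by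
  let i : C(A, B) := ⟨Set.inclusion hAB, continuous_inclusion hAB⟩
  let r : C(B, A) := ⟨fun x => ⟨φ (1, x), h1 x x.2⟩, by fun_prop⟩
  refine ⟨⟨r, i, ?_, ?_⟩⟩
  · refine ContinuousMap.Homotopic.symm ⟨⟨⟨fun p => ⟨φ (p.1, p.2), hB _ _ p.2.2⟩, by fun_prop⟩,
      fun x => Subtype.ext (h0 x x.2), fun x => rfl⟩⟩
  · have : r.comp i = ContinuousMap.id A := by
      ext x
      exact hA 1 x x.2
    rw [this]

/-- An elementary collapse does not change the homotopy type. With `t` the minimum of the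
coordinates on `σ`, the deformation moves mass `t` from each vertex of `σ` to `u`; it is the identity
outside the two simplices removed, where `t = 0`. -/
theorem nonempty_homotopyEquiv_of_elementary_collapse [DecidableEq V] {K : Set (Finset V)}
    (hK : IsLowerSet K) {σ : Finset V} {u : V} (hσ : σ.Nonempty) (hu : u ∉ σ)
    (hτ : insert u σ ∈ K) (hfree : ∀ τ ∈ K, σ ⊆ τ → τ = σ ∨ τ = insert u σ) :
    Nonempty (ContinuousMap.HomotopyEquiv (realize K)
      (realize (K \ {σ, insert u σ} : Set (Finset V)))) := by
  let T : (V → ℝ) → ℝ := fun w => σ.inf' hσ w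
  have hT : Continuous T := Continuous.finset_inf'_apply hσ fun v _ => continuous_apply v
  let φ : unitInterval × (V → ℝ) → V → ℝ := fun p v =>
    p.2 v + p.1 * T p.2 * (if v = u then (σ.card : ℝ) else if v ∈ σ then -1 else 0)
  have hφ : Continuous φ := by
    refine continuous_pi fun v => ?_
    change Continuous fun p : unitInterval × (V → ℝ) =>
      p.2 v + p.1 * T p.2 * (if v = u then (σ.card : ℝ) else if v ∈ σ then -1 else 0)
    fun_prop
  have hTle : ∀ w : V → ℝ, ∀ v ∈ σ, T w ≤ w v := fun w v hv => Finset.inf'_le _ hv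
  have hTmem : ∀ w : V → ℝ, ∃ v ∈ σ, T w = w v := fun w =>
    let ⟨v, hv, h⟩ := Finset.exists_mem_eq_inf' hσ w
    ⟨v, hv, h⟩
  have hT0 : ∀ w : V → ℝ, T w = 0 → ∀ t, φ (t, w) = w := by
    intro w hw t
    funext v
    simp [φ, hw]
  -- a face minus a vertex of `σ` is one of the remaining simplices
  have herase : ∀ s ∈ K, ∀ v ∈ σ, s.erase v ∈ K \ {σ, insert u σ} := by
    intro s hs v hv
    refine ⟨hK (Finset.erase_subset _ _) hs, ?_⟩
    rintro (h | h)
    · exact Finset.notMem_erase v s (h ▸ hv)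
    · exact Finset.notMem_erase v s (h ▸ Finset.mem_insert_of_mem hv)
  have hTnn : ∀ w ∈ realize K, 0 ≤ T w := by
    rintro w ⟨s, -, h0, -⟩
    obtain ⟨v, -, h⟩ := hTmem w
    exact h ▸ h0 v
  have hpos : ∀ w ∈ realize K, 0 < T w → (∀ v, 0 ≤ w v) ∧ (∀ v, v ∉ insert u σ → w v = 0) ∧
      ∑ v ∈ insert u σ, w v = 1 := by
    rintro w ⟨s, hs, h0, h1, h2⟩ hw
    have hσs : σ ⊆ s := by
      intro v hv
      by_contra hvs
      have := hTle w v hv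
      rw [h1 v hvs] at this
      exact absurd hw this.not_gt
    rcases hfree s hs hσs with rfl | rfl
    · refine ⟨h0, fun v hv => h1 v fun h => hv (Finset.mem_insert_of_mem h), ?_⟩
      rw [Finset.sum_insert hu, h1 u hu, h2, zero_add]
    · exact ⟨h0, h1, h2⟩
  have hφpos : ∀ w ∈ realize K, 0 < T w → ∀ t : unitInterval, (∀ v, 0 ≤ φ (t, w) v) ∧
      (∀ v, v ∉ insert u σ → φ (t, w) v = 0) ∧ ∑ v ∈ insert u σ, φ (t, w) v = 1 := by
    intro w hw hTw t
    obtain ⟨h0, h1, h2⟩ := hpos w hw hTw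
    refine ⟨fun v => ?_, fun v hv => ?_, ?_⟩
    · simp only [φ]
      split_ifs with hvu hvσ
      · have := h0 v
        have := t.2.1
        positivity
      · nlinarith [hTle w v hvσ, t.2.1, t.2.2]
      · simpa using h0 v
    · rw [Finset.mem_insert, not_or] at hv
      simp [φ, hv.1, hv.2, h1 v (by simp [hv])]
    · have e : ∑ v ∈ insert u σ, (if v = u then (σ.card : ℝ) else if v ∈ σ then -1 else 0) = 0 := by
        rw [Finset.sum_insert hu, if_pos rfl]
        have : ∑ v ∈ σ, (if v = u then (σ.card : ℝ) else if v ∈ σ then -1 else 0) =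
            ∑ v ∈ σ, (-1 : ℝ) := by
          refine Finset.sum_congr rfl fun v hv => ?_
          rw [if_neg (by rintro rfl; exact hu hv), if_pos hv]
        rw [this]
        simp
      simp only [φ]
      rw [Finset.sum_add_distrib, ← Finset.mul_sum, e, h2]
      simp
  refine nonempty_homotopyEquiv_of_deformation (realize_mono Set.sdiff_subset) φ hφ ?_ ?_ ?_ ?_
  · intro w _
    funext v
    simp [φ]
  · intro t w hw
    rcases (hTnn w hw).eq_or_lt with h | h
    · rwa [hT0 w h.symm]
    · exact ⟨_, hτ, hφpos w hw h t⟩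
  · intro w hw
    rcases (hTnn w hw).eq_or_lt with h | h
    · rw [hT0 w h.symm]
      obtain ⟨v, hv, hvT⟩ := hTmem w
      obtain ⟨s, hs, h0, h1, h2⟩ := hw
      exact ⟨s.erase v, herase s hs v hv, h0, sum_erase_eq_one h1 h2 (hvT.symm.trans h.symm)⟩
    · obtain ⟨v, hv, hvT⟩ := hTmem w
      obtain ⟨h0, h1, h2⟩ := hφpos w hw h 1
      refine ⟨(insert u σ).erase v, herase _ hτ v hv, h0, sum_erase_eq_one h1 h2 ?_⟩
      have hvu : v ≠ u := by rintro rfl; exact hu hv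
      simp [φ, hvT, hv, hvu]
  · rintro t w ⟨s, ⟨hs, hs'⟩, h0, h1, h2⟩
    refine hT0 w (le_antisymm ?_ (hTnn w ⟨s, hs, h0, h1, h2⟩)) t
    by_contra hlt
    push Not at hlt
    refine hs' (hfree s hs fun v hv => ?_)
    by_contra hvs
    have := hTle w v hv
    rw [h1 v hvs] at this
    exact absurd hlt this.not_gt

theorem realize_vertex_eq_singleton [DecidableEq V] {K : Set (Finset V)} {u : V} (hu : {u} ∈ K)
    (hK : ∀ τ ∈ K, τ = ∅ ∨ τ = {u}) : realize K = {Pi.single u 1} := by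
  ext w
  constructor
  · rintro ⟨s, hs, -, h1, h2⟩
    rcases hK s hs with rfl | rfl
    · simp at h2
    · funext v
      by_cases hv : v = u
      · subst hv
        simpa using h2
      · rw [h1 v (by simpa using hv), Pi.single_eq_of_ne hv]
  · rintro rfl
    refine ⟨{u}, hu, fun v => ?_, fun v hv => ?_, by simp⟩
    · by_cases hv : v = u
      · subst hv
        simp
      · rw [Pi.single_eq_of_ne hv]
    · exact Pi.single_eq_of_ne (by simpa using hv) _

theorem Collapsible.contractibleSpace [DecidableEq V] {K : Finset (Finset V)} (h : Collapsible K)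
    (hK : IsLowerSet (K : Set (Finset V))) (hne : K.Nonempty) :
    ContractibleSpace (realize (K : Set (Finset V))) := by
  induction h with
  | void => simp at hne
  | step K σ u hu hσ hτ hfree h ih =>
    rcases σ.eq_empty_or_nonempty with rfl | hσne
    · have h1 : realize (K : Set (Finset V)) = {Pi.single u 1} :=
        realize_vertex_eq_singleton (by simpa using hτ) fun τ hτ => by
          simpa using hfree τ hτ (Finset.empty_subset _)
      rw [h1]
      infer_instance
    · obtain ⟨e⟩ := nonempty_homotopyEquiv_of_elementary_collapse hK hσne hu hτ hfree
      have hcoe : ((K \ {σ, insert u σ} : Finset (Finset V)) : Set (Finset V)) =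
          (K : Set (Finset V)) \ {σ, insert u σ} := by
        simp
      have hlow : IsLowerSet ((K \ {σ, insert u σ} : Finset (Finset V)) : Set (Finset V)) := by
        intro s t hts hs
        rw [hcoe] at hs ⊢
        refine ⟨hK hts hs.1, fun ht => hs.2 ?_⟩
        have hσt : σ ⊆ t := by
          rcases ht with rfl | rfl
          · exact subset_rfl
          · exact Finset.subset_insert _ _
        exact hfree s hs.1 (hσt.trans hts)
      have hmem : (∅ : Finset V) ∈ K \ {σ, insert u σ} := by
        simp only [Finset.mem_sdiff, Finset.mem_insert, Finset.mem_singleton, not_or]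
        exact ⟨hK (Finset.empty_subset σ) hσ, hσne.ne_empty.symm,
          (Finset.insert_ne_empty _ _).symm⟩
      have := ih hlow ⟨_, hmem⟩
      rw [hcoe] at this
      exact e.contractibleSpace

end Realization

/-! ### Collapsing a contractible subcomplex -/

section Quotient

/-- Collapsing `A` is a homotopy equivalence if some homotopy of the whole space, starting from the
identity, contracts `A` in itself. -/
theorem nonempty_homotopyEquiv_of_isQuotientMap {X W : Type*} [TopologicalSpace X]
    [TopologicalSpace W] {A : Set X} {a₀ : X} (G : C(unitInterval × X, X))
    (h0 : ∀ x, G (0, x) = x) (hA : ∀ t, ∀ a ∈ A, G (t, a) ∈ A) (h1 : ∀ a ∈ A, G (1, a) = a₀)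
    {q : X → W} (hq : Topology.IsQuotientMap q) (hconst : ∀ x ∈ A, ∀ y ∈ A, q x = q y)
    (hinj : ∀ x y, q x = q y → x = y ∨ x ∈ A ∧ y ∈ A) :
    Nonempty (ContinuousMap.HomotopyEquiv X W) := by
  let s := Function.surjInv hq.surjective
  have hs : ∀ z, q (s z) = z := Function.surjInv_eq hq.surjective
  have hG1 : ∀ x, G (1, s (q x)) = G (1, x) := by
    intro x
    rcases hinj _ _ (hs (q x)) with h | ⟨h, h'⟩
    · rw [h]
    · rw [h1 _ h, h1 _ h']
  have hqG : ∀ t x, q (G (t, s (q x))) = q (G (t, x)) := by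
    intro t x
    rcases hinj _ _ (hs (q x)) with h | ⟨h, h'⟩
    · rw [h]
    · exact hconst _ (hA t _ h) _ (hA t _ h')
  have hg : Continuous fun z => G (1, s z) := by
    refine hq.continuous_iff.2 ?_
    have : (fun z => G (1, s z)) ∘ q = fun x => G (1, x) := funext hG1
    rw [this]
    fun_prop
  have hH : Continuous fun p : unitInterval × W => q (G (p.1, s p.2)) := by
    refine hq.continuous_lift_prod_right ?_
    simp only [hqG]
    exact hq.continuous.comp G.continuous
  let Q : C(X, W) := ⟨q, hq.continuous⟩
  let g : C(W, X) := ⟨fun z => G (1, s z), hg⟩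
  refine ⟨⟨Q, g, ?_, ?_⟩⟩
  · exact ContinuousMap.Homotopic.symm ⟨⟨G, h0, fun x => (hG1 x).symm⟩⟩
  · exact ContinuousMap.Homotopic.symm
      ⟨⟨⟨_, hH⟩, fun z => (congrArg q (h0 _)).trans (hs z), fun z => rfl⟩⟩

end Quotient

section Facets

variable {V : Type*}

/-- The least coordinate of `w` on the set `f` (`0` if `f` is empty). -/
noncomputable def minCoord (f : Finset V) (w : V → ℝ) : ℝ :=
  if h : f.Nonempty then f.inf' h w else 0

theorem minCoord_le {f : Finset V} {v : V} (hv : v ∈ f) (w : V → ℝ) : minCoord f w ≤ w v := by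
  rw [minCoord, dif_pos ⟨v, hv⟩]
  exact Finset.inf'_le _ hv

theorem exists_eq_minCoord {f : Finset V} (hf : f.Nonempty) (w : V → ℝ) :
    ∃ v ∈ f, w v = minCoord f w := by
  rw [minCoord, dif_pos hf]
  obtain ⟨v, hv, h⟩ := Finset.exists_mem_eq_inf' hf w
  exact ⟨v, hv, h.symm⟩

theorem continuous_minCoord (f : Finset V) : Continuous (minCoord f) := by
  by_cases hf : f.Nonempty
  · have : minCoord f = fun w => f.inf' hf w := by
      funext w
      rw [minCoord, dif_pos hf]
    rw [this]
    exact Continuous.finset_inf'_apply hf fun v _ => continuous_apply v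
  · have : minCoord f = fun _ => 0 := by
      funext w
      rw [minCoord, dif_neg hf]
    rw [this]
    exact continuous_const

/-- `F` is a set of `d`-dimensional simplices of the at most `d`-dimensional complex `K` (given with
its empty simplex). -/
structure IsFacetSet (K F : Finset (Finset V)) (d : ℕ) : Prop where
  isLowerSet : IsLowerSet (K : Set (Finset V))
  subset : F ⊆ K
  card_le : ∀ s ∈ K, s.card ≤ d + 1
  card_eq : ∀ f ∈ F, f.card = d + 1

namespace IsFacetSet

variable {K F : Finset (Finset V)} {d : ℕ}

theorem nonempty_of_mem {f : Finset V} (h : IsFacetSet K F d) (hf : f ∈ F) : f.Nonempty :=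
  Finset.card_pos.1 (by rw [h.card_eq f hf]; omega)

theorem eq_of_subset {f s : Finset V} (h : IsFacetSet K F d) (hf : f ∈ F) (hs : s ∈ K)
    (hfs : f ⊆ s) : f = s :=
  Finset.eq_of_subset_of_card_le hfs ((h.card_le s hs).trans (h.card_eq f hf).ge)

theorem minCoord_nonneg {f : Finset V} {w : V → ℝ} (hw : w ∈ realize (K : Set (Finset V))) :
    0 ≤ minCoord f w := by
  obtain ⟨s, -, h0, -⟩ := hw
  by_cases hf : f.Nonempty
  · obtain ⟨v, -, e⟩ := exists_eq_minCoord hf w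
    exact e ▸ h0 v
  · rw [minCoord, dif_neg hf]

theorem eq_of_minCoord_pos {f s : Finset V} {w : V → ℝ} (h : IsFacetSet K F d) (hf : f ∈ F)
    (hs : s ∈ K) (hw : ∀ v, v ∉ s → w v = 0) (hpos : 0 < minCoord f w) : f = s := by
  refine h.eq_of_subset hf hs fun v hv => ?_
  by_contra hvs
  have := minCoord_le hv w
  rw [hw v hvs] at this
  exact absurd hpos this.not_gt

/-- A point with positive coordinates on a facet lies in that facet. -/
theorem supported_of_minCoord_pos {f : Finset V} {w : V → ℝ} (h : IsFacetSet K F d) (hf : f ∈ F)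
    (hw : w ∈ realize (K : Set (Finset V))) (hpos : 0 < minCoord f w) :
    (∀ v, 0 ≤ w v) ∧ (∀ v, v ∉ f → w v = 0) ∧ ∑ v ∈ f, w v = 1 := by
  obtain ⟨s, hs, h0, h1, h2⟩ := hw
  obtain rfl := h.eq_of_minCoord_pos hf hs h1 hpos
  exact ⟨h0, h1, h2⟩

theorem minCoord_eq_zero_of_ne {f g : Finset V} {w : V → ℝ} (h : IsFacetSet K F d) (hf : f ∈ F)
    (hg : g ∈ F) (hfg : g ≠ f) (hw : w ∈ realize (K : Set (Finset V))) (hpos : 0 < minCoord f w) :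
    minCoord g w = 0 := by
  refine le_antisymm (not_lt.1 fun hlt => hfg ?_) (minCoord_nonneg hw)
  exact h.eq_of_minCoord_pos hg (h.subset hf) (h.supported_of_minCoord_pos hf hw hpos).2.1 hlt

variable [DecidableEq V]

theorem erase_mem {s : Finset V} {v : V} (h : IsFacetSet K F d) (hs : s ∈ K) (hv : v ∈ s) :
    s.erase v ∈ K \ F := by
  refine Finset.mem_sdiff.2 ⟨h.isLowerSet (Finset.erase_subset _ _) hs, fun hF => ?_⟩
  have h1 := h.card_eq _ hF
  have h2 := h.card_le _ hs
  have h3 := Finset.card_erase_lt_of_mem hv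
  omega

theorem mem_realize_sdiff_iff {w : V → ℝ} (h : IsFacetSet K F d)
    (hw : w ∈ realize (K : Set (Finset V))) :
    w ∈ realize ((K \ F : Finset (Finset V)) : Set (Finset V)) ↔ ∀ f ∈ F, minCoord f w = 0 := by
  constructor
  · rintro ⟨s, hs, -, h1, -⟩ f hf
    rw [Finset.mem_coe, Finset.mem_sdiff] at hs
    refine le_antisymm (not_lt.1 fun hlt => hs.2 ?_) (minCoord_nonneg hw)
    exact h.eq_of_minCoord_pos hf hs.1 h1 hlt ▸ hf
  · intro hall
    obtain ⟨s, hs, h0, h1, h2⟩ := hw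
    by_cases hsF : s ∈ F
    · obtain ⟨v, hv, e⟩ := exists_eq_minCoord (h.nonempty_of_mem hsF) w
      exact ⟨s.erase v, Finset.mem_coe.2 (h.erase_mem hs hv), h0,
        sum_erase_eq_one h1 h2 (e.trans (hall s hsF))⟩
    · exact ⟨s, Finset.mem_coe.2 (Finset.mem_sdiff.2 ⟨hs, hsF⟩), h0, h1, h2⟩

/-- Contractibility of the subcomplex obtained by removing the facets in `F` extends to a homotopy
of the whole complex.

In the facet `f`, write a point as `m` times the sum of the vertices of `f` plus the rest, where
`m = minCoord f w`. At time `t`, the points with `m` at least `t / (2 * (d + 1))` are stretched to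
the whole facet by the map `b` below, while the points of the collar with smaller `m` are projected
radially to the boundary of `f` by `b` and then follow the contraction for the remaining time. -/
theorem exists_homotopy_extension (h : IsFacetSet K F d)
    [hc : ContractibleSpace (realize ((K \ F : Finset (Finset V)) : Set (Finset V)))] :
    ∃ (G : C(unitInterval × realize (K : Set (Finset V)), realize (K : Set (Finset V))))
      (a₀ : realize (K : Set (Finset V))),
      (∀ x, G (0, x) = x) ∧
      (∀ t, ∀ a : realize (K : Set (Finset V)),
        (a : V → ℝ) ∈ realize ((K \ F : Finset (Finset V)) : Set (Finset V)) →
        (G (t, a) : V → ℝ) ∈ realize ((K \ F : Finset (Finset V)) : Set (Finset V))) ∧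
      ∀ a : realize (K : Set (Finset V)),
        (a : V → ℝ) ∈ realize ((K \ F : Finset (Finset V)) : Set (Finset V)) →
        G (1, a) = a₀ := by
  have hsubK : realize ((K \ F : Finset (Finset V)) : Set (Finset V)) ⊆
      realize (K : Set (Finset V)) :=
    realize_mono (Finset.coe_subset.2 Finset.sdiff_subset)
  set A := realize ((K \ F : Finset (Finset V)) : Set (Finset V))
  set B := realize (K : Set (Finset V))
  obtain ⟨c₀, ⟨H⟩⟩ := id_nullhomotopic A
  have hd : (0 : ℝ) < d + 1 := by positivity
  let s : unitInterval → ℝ := fun t => t / (2 * (d + 1))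
  have hs0 : ∀ t, 0 ≤ s t := fun t => div_nonneg t.2.1 (by positivity)
  have hs1 : ∀ t, (d + 1) * s t ≤ 1 / 2 := by
    intro t
    have : (d + 1) * s t = t / 2 := by
      simp only [s]
      field_simp
    rw [this]
    linarith [t.2.2]
  let M : (V → ℝ) → ℝ := fun w => ∑ f ∈ F, minCoord f w
  let m : unitInterval × B → Finset V → ℝ := fun p f => min (minCoord f (p.2 : V → ℝ)) (s p.1)
  let b : unitInterval × B → V → ℝ := fun p v =>
    ((p.2 : V → ℝ) v - ∑ f ∈ F, if v ∈ f then m p f else 0) / (1 - (d + 1) * ∑ f ∈ F, m p f)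
  have hM : Continuous M := continuous_finsetSum _ fun f _ => continuous_minCoord f
  have hscont : Continuous s := by fun_prop
  have hm : ∀ f, Continuous fun p => m p f := fun f =>
    ((continuous_minCoord f).comp (continuous_subtype_val.comp continuous_snd)).min
      (hscont.comp continuous_fst)
  -- Off the facets in `F`, the map `b` is the identity.
  have hb0 : ∀ p : unitInterval × B, (∀ f ∈ F, minCoord f (p.2 : V → ℝ) = 0) →
      ∑ f ∈ F, m p f = 0 ∧ b p = p.2 := by
    intro p hp
    have hmz : ∀ f ∈ F, m p f = 0 := fun f hf => by
      simp only [m]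
      rw [hp f hf, min_eq_left (hs0 _)]
    refine ⟨Finset.sum_eq_zero hmz, ?_⟩
    funext v
    simp only [b]
    rw [Finset.sum_eq_zero hmz, Finset.sum_eq_zero fun f hf => by rw [hmz f hf, ite_self]]
    simp
  -- Inside a facet of `F`, only the term of that facet contributes.
  have hb1 : ∀ (p : unitInterval × B), ∀ f ∈ F, 0 < minCoord f (p.2 : V → ℝ) →
      M p.2 = minCoord f (p.2 : V → ℝ) ∧ ∑ g ∈ F, m p g = m p f ∧
        ∀ v, b p v = ((p.2 : V → ℝ) v - if v ∈ f then m p f else 0) / (1 - (d + 1) * m p f) := by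
    intro p f hf hpos
    have hz : ∀ g ∈ F, g ≠ f → minCoord g (p.2 : V → ℝ) = 0 := fun g hg hgf =>
      h.minCoord_eq_zero_of_ne hf hg hgf p.2.2 hpos
    have hmz : ∀ g ∈ F, g ≠ f → m p g = 0 := fun g hg hgf => by
      simp only [m]
      rw [hz g hg hgf, min_eq_left (hs0 _)]
    have e1 : ∑ g ∈ F, m p g = m p f :=
      Finset.sum_eq_single f hmz fun hf' => absurd hf hf'
    refine ⟨Finset.sum_eq_single f hz fun hf' => absurd hf hf', e1, fun v => ?_⟩
    simp only [b]
    rw [e1, Finset.sum_eq_single f (fun g hg hgf => by rw [hmz g hg hgf, ite_self])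
      fun hf' => absurd hf hf']
  have hcase : ∀ p : unitInterval × B, (∀ f ∈ F, minCoord f (p.2 : V → ℝ) = 0) ∨
      ∃ f ∈ F, 0 < minCoord f (p.2 : V → ℝ) := by
    intro p
    by_cases hp : ∃ f ∈ F, 0 < minCoord f (p.2 : V → ℝ)
    · exact Or.inr hp
    · push Not at hp
      exact Or.inl fun f hf => le_antisymm (hp f hf) (minCoord_nonneg p.2.2)
  have hden : ∀ p, (0 : ℝ) < 1 - (d + 1) * ∑ f ∈ F, m p f := by
    intro p
    rcases hcase p with hp | ⟨f, hf, hp⟩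
    · rw [(hb0 p hp).1]
      norm_num
    · rw [(hb1 p f hf hp).2.1]
      have : (d + 1) * m p f ≤ (d + 1) * s p.1 :=
        mul_le_mul_of_nonneg_left (min_le_right _ _) hd.le
      linarith [hs1 p.1]
  have hbcont : Continuous b := by
    refine continuous_pi fun v => ?_
    refine Continuous.div ?_ ?_ fun p => (hden p).ne'
    · refine Continuous.sub ?_ (continuous_finsetSum _ fun f _ => ?_)
      · exact (continuous_apply v).comp (continuous_subtype_val.comp continuous_snd)
      · split_ifs
        · exact hm f
        · exact continuous_const
    · exact continuous_const.sub (continuous_const.mul (continuous_finsetSum _ fun f _ => hm f))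
  have hbsupp : ∀ (p : unitInterval × B), ∀ f ∈ F, 0 < minCoord f (p.2 : V → ℝ) →
      (∀ v, 0 ≤ b p v) ∧ (∀ v, v ∉ f → b p v = 0) ∧ ∑ v ∈ f, b p v = 1 := by
    intro p f hf hp
    obtain ⟨-, hsum, hb⟩ := hb1 p f hf hp
    have hden' := hden p
    rw [hsum] at hden'
    obtain ⟨h0, h1, h2⟩ := h.supported_of_minCoord_pos hf p.2.2 hp
    refine ⟨fun v => ?_, fun v hv => ?_, ?_⟩
    · rw [hb]
      refine div_nonneg (sub_nonneg.2 ?_) hden'.le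
      split_ifs with hv
      · exact (min_le_left _ _).trans (minCoord_le hv _)
      · exact h0 v
    · rw [hb, h1 v hv, if_neg hv]
      simp
    · simp only [hb]
      rw [← Finset.sum_div, Finset.sum_sub_distrib, h2,
        Finset.sum_congr rfl fun v hv => if_pos hv, Finset.sum_const, h.card_eq f hf, nsmul_eq_mul]
      push_cast
      exact div_self hden'.ne'
  have hbB : ∀ p, b p ∈ B := by
    intro p
    rcases hcase p with hp | ⟨f, hf, hp⟩
    · rw [(hb0 p hp).2]
      exact p.2.2
    · exact ⟨f, Finset.mem_coe.2 (h.subset hf), hbsupp p f hf hp⟩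
  have hbA : ∀ p : unitInterval × B, M p.2 ≤ s p.1 → b p ∈ A := by
    intro p hMp
    rcases hcase p with hp | ⟨f, hf, hp⟩
    · rw [(hb0 p hp).2]
      exact (h.mem_realize_sdiff_iff p.2.2).2 hp
    · obtain ⟨h0, h1, h2⟩ := hbsupp p f hf hp
      obtain ⟨hMf, -, hb⟩ := hb1 p f hf hp
      obtain ⟨v, hv, e⟩ := exists_eq_minCoord (h.nonempty_of_mem hf) (p.2 : V → ℝ)
      refine ⟨f.erase v, Finset.mem_coe.2 (h.erase_mem (h.subset hf) hv), h0,
        sum_erase_eq_one h1 h2 ?_⟩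
      rw [hb, if_pos hv, e]
      simp only [m]
      rw [min_eq_left (hMf ▸ hMp), sub_self, zero_div]
  let τ : unitInterval × B → unitInterval := fun p =>
    Set.projIcc 0 1 zero_le_one ((p.1 : ℝ) - 2 * (d + 1) * M p.2)
  have hτcont : Continuous τ := by
    refine continuous_projIcc.comp (Continuous.sub (by fun_prop) (continuous_const.mul ?_))
    exact hM.comp (continuous_subtype_val.comp continuous_snd)
  classical
  let G : unitInterval × B → B := fun p =>
    if hp : M p.2 ≤ s p.1 then ⟨H (τ p, ⟨b p, hbA p hp⟩), hsubK (Subtype.coe_prop _)⟩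
    else ⟨b p, hbB p⟩
  have hGcont : Continuous G := by
    have hMc : Continuous fun p : unitInterval × B => M p.2 :=
      hM.comp (continuous_subtype_val.comp continuous_snd)
    have hsc : Continuous fun p : unitInterval × B => s p.1 := hscont.comp continuous_fst
    have hcover : {p : unitInterval × B | M p.2 ≤ s p.1} ∪ {p | s p.1 ≤ M p.2} = Set.univ := by
      ext p
      simpa using le_total (M p.2) (s p.1)
    rw [← continuousOn_univ, ← hcover]
    refine ContinuousOn.union_of_isClosed ?_ ?_ (isClosed_le hMc hsc) (isClosed_le hsc hMc)
    · rw [continuousOn_iff_continuous_domRestrict]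
      have e : Set.domRestrict {p : unitInterval × B | M p.2 ≤ s p.1} G = fun p =>
          ⟨H (τ p.1, ⟨b p.1, hbA p.1 p.2⟩), hsubK (Subtype.coe_prop _)⟩ := by
        funext p
        exact dif_pos p.2
      rw [e]
      fun_prop
    · rw [continuousOn_iff_continuous_domRestrict]
      have e : Set.domRestrict {p : unitInterval × B | s p.1 ≤ M p.2} G = fun p =>
          ⟨b p.1, hbB p.1⟩ := by
        funext p
        by_cases hp : M p.1.2 ≤ s p.1.1
        · refine (dif_pos hp).trans (Subtype.ext ?_)
          have hτ0 : τ p.1 = 0 := by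
            refine Set.projIcc_of_le_left _ ?_
            rw [le_antisymm hp p.2]
            simp only [s]
            field_simp
            simp
          change (H (τ p.1, _) : V → ℝ) = b p.1
          rw [hτ0, H.apply_zero]
          rfl
        · exact dif_neg hp
      rw [e]
      fun_prop
  have hGA : ∀ (t : unitInterval) (a : B) (ha : (a : V → ℝ) ∈ A),
      (G (t, a) : V → ℝ) = H (t, ⟨a, ha⟩) := by
    intro t a ha
    have hz := (h.mem_realize_sdiff_iff a.2).1 ha
    have hMz : M a = 0 := Finset.sum_eq_zero hz
    have hb := (hb0 (t, a) hz).2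
    have hp : M a ≤ s t := hMz ▸ hs0 t
    have hτt : τ (t, a) = t := by
      simp only [τ]
      rw [hMz, mul_zero, sub_zero]
      exact Set.projIcc_val _ t
    have e : G (t, a) = ⟨H (τ (t, a), ⟨b (t, a), hbA _ hp⟩), hsubK (Subtype.coe_prop _)⟩ :=
      dif_pos hp
    rw [e]
    simp only [hτt, hb]
  refine ⟨⟨G, hGcont⟩, ⟨c₀, hsubK c₀.2⟩, fun x => Subtype.ext ?_, fun t a ha => ?_,
    fun a ha => Subtype.ext ?_⟩
  · have hs00 : s 0 = 0 := by simp [s]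
    rcases hcase (0, x) with hp | ⟨f, hf, hp⟩
    · have hxA : (x : V → ℝ) ∈ A := (h.mem_realize_sdiff_iff x.2).2 hp
      change (G (0, x) : V → ℝ) = x
      rw [hGA 0 x hxA, H.apply_zero]
      rfl
    · obtain ⟨hMf, -, hb⟩ := hb1 (0, x) f hf hp
      have hnot : ¬ M x ≤ s 0 := by
        rw [hs00, not_le]
        exact hp.trans_eq hMf.symm
      have e : G (0, x) = ⟨b (0, x), hbB _⟩ := dif_neg hnot
      change (G (0, x) : V → ℝ) = x
      rw [e]
      funext v
      have hm0 : m (0, x) f = 0 := by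
        simp only [m]
        rw [hs00, min_eq_right hp.le]
      change b (0, x) v = _
      rw [hb, hm0]
      simp
  · change (G (t, a) : V → ℝ) ∈ A
    rw [hGA t a ha]
    exact Subtype.coe_prop _
  · change (G (1, a) : V → ℝ) = c₀
    rw [hGA 1 a ha, H.apply_one]
    rfl

end IsFacetSet

end Facets

/-! ### The quotient map to a wedge of spheres -/

section Wedge

/-- The map from a wedge of spheres to the product of the spheres. -/
noncomputable def wedgeToPi (k d : ℕ) : WedgeOfSpheres k d → Fin k → UnitSphere d :=
  Quot.lift (Sum.elim (fun _ _ => UnitSphere.base d)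
    fun x => Function.update (fun _ => UnitSphere.base d) x.1 x.2) (by
      rintro _ _ ⟨i⟩
      exact (Function.update_eq_self i _).symm)

theorem continuous_wedgeToPi (k d : ℕ) : Continuous (wedgeToPi k d) := by
  refine continuous_quot_lift _ (continuous_sum_dom.2 ⟨continuous_const, ?_⟩)
  refine continuous_sigma fun i => ?_
  exact continuous_const.update i continuous_id

theorem wedgeToPi_injective (k d : ℕ) : Function.Injective (wedgeToPi k d) := by
  have key : ∀ i x, wedgeToPi k d (Quot.mk _ (Sum.inr ⟨i, x⟩)) = (fun _ => UnitSphere.base d) →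
      (Quot.mk _ (Sum.inl ()) : WedgeOfSpheres k d) = Quot.mk _ (Sum.inr ⟨i, x⟩) := by
    intro i x h
    have hx : x = UnitSphere.base d := by simpa [wedgeToPi] using congrFun h i
    subst hx
    exact Quot.sound (WedgeRel.glue i)
  rintro ⟨⟨⟩ | ⟨i, x⟩⟩ ⟨⟨⟩ | ⟨j, y⟩⟩ h
  · rfl
  · exact key j y h.symm
  · exact (key i x h).symm
  · by_cases hij : i = j
    · subst hij
      have hxy : x = y := by simpa [wedgeToPi] using congrFun h i
      rw [hxy]
    · have hx : x = UnitSphere.base d := by simpa [wedgeToPi, hij] using congrFun h i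
      have hy : y = UnitSphere.base d := by
        simpa [wedgeToPi, Ne.symm hij] using (congrFun h j).symm
      subst hx hy
      exact (Quot.sound (WedgeRel.glue i)).symm.trans (Quot.sound (WedgeRel.glue j))

instance (k d : ℕ) : CompactSpace (WedgeOfSpheres k d) :=
  inferInstanceAs (CompactSpace (Quot _))

theorem isClosedEmbedding_wedgeToPi (k d : ℕ) : Topology.IsClosedEmbedding (wedgeToPi k d) :=
  (continuous_wedgeToPi k d).isClosedEmbedding (wedgeToPi_injective k d)

/-- For `m = minimum of x`, the inverse stereographic projection of the point with coordinates
`(x (i + 1) - x 0) / m`, written without the division, so that it extends by the base point to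
`m = 0`. The term `1 - ∑ i, x i` vanishes where the `x i` are the barycentric coordinates of a point
of the simplex on these `d + 1` vertices, and keeps the denominator positive at the points of the
complex where all of the `x i` are zero. -/
noncomputable def stereoVec {d : ℕ} (x : Fin (d + 1) → ℝ) (m : ℝ) :
    EuclideanSpace ℝ (Fin (d + 1)) :=
  WithLp.toLp 2 (Fin.cons
    (((∑ i : Fin d, (x i.succ - x 0) ^ 2) + (1 - ∑ i, x i) ^ 2 - m ^ 2) /
      ((∑ i : Fin d, (x i.succ - x 0) ^ 2) + (1 - ∑ i, x i) ^ 2 + m ^ 2))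
    fun i => 2 * m * (x i.succ - x 0) /
      ((∑ i : Fin d, (x i.succ - x 0) ^ 2) + (1 - ∑ i, x i) ^ 2 + m ^ 2))

theorem stereoVec_denominator_pos {d : ℕ} {x : Fin (d + 1) → ℝ} {m : ℝ} (hm : ∃ i, x i = m) :
    0 < (∑ i : Fin d, (x i.succ - x 0) ^ 2) + (1 - ∑ i, x i) ^ 2 + m ^ 2 := by
  have h1 : 0 ≤ ∑ i : Fin d, (x i.succ - x 0) ^ 2 := Finset.sum_nonneg fun i _ => sq_nonneg _
  have h2 := sq_nonneg (1 - ∑ i, x i)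
  have h3 := sq_nonneg m
  refine lt_of_le_of_ne (by positivity) fun h => ?_
  have e1 : ∑ i : Fin d, (x i.succ - x 0) ^ 2 = 0 := by linarith
  have e2 : (1 - ∑ i, x i) ^ 2 = 0 := by linarith
  have e3 : m ^ 2 = 0 := by linarith
  have e4 : ∀ i, x i = x 0 := by
    intro i
    refine Fin.cases rfl (fun i => ?_) i
    have := (Finset.sum_eq_zero_iff_of_nonneg fun i _ => sq_nonneg _).1 e1 i (Finset.mem_univ _)
    exact sub_eq_zero.1 (pow_eq_zero_iff two_ne_zero |>.1 this)
  obtain ⟨i, hi⟩ := hm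
  have e5 : ∀ j, x j = 0 := fun j => by
    rw [e4 j, ← e4 i, hi, pow_eq_zero_iff two_ne_zero |>.1 e3]
  simp [e5] at e2

theorem continuous_stereoVec {X : Type*} [TopologicalSpace X] {d : ℕ} {x : X → Fin (d + 1) → ℝ}
    {m : X → ℝ} (hx : Continuous x) (hm : Continuous m) (hxm : ∀ w, ∃ i, x w i = m w) :
    Continuous fun w => stereoVec (x w) (m w) := by
  refine (PiLp.continuous_toLp 2 _).comp (continuous_pi fun j => ?_)
  refine Fin.cases ?_ (fun j => ?_) j
  · simp only [Fin.cons_zero]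
    exact Continuous.div (by fun_prop) (by fun_prop)
      fun w => (stereoVec_denominator_pos (hxm w)).ne'
  · simp only [Fin.cons_succ]
    exact Continuous.div (by fun_prop) (by fun_prop)
      fun w => (stereoVec_denominator_pos (hxm w)).ne'

theorem stereoVec_mem_sphere {d : ℕ} {x : Fin (d + 1) → ℝ} {m : ℝ} (hm : ∃ i, x i = m)
    (hx : m = 0 ∨ ∑ i, x i = 1) :
    stereoVec x m ∈ Metric.sphere (0 : EuclideanSpace ℝ (Fin (d + 1))) 1 := by
  have hpos := stereoVec_denominator_pos hm
  rw [mem_sphere_zero_iff_norm, EuclideanSpace.norm_eq, Real.sqrt_eq_one, Fin.sum_univ_succ]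
  simp only [stereoVec, Fin.cons_zero, Fin.cons_succ, Real.norm_eq_abs, sq_abs, div_pow, mul_pow]
  rw [← Finset.sum_div, ← Finset.mul_sum, ← add_div, div_eq_one_iff_eq (by positivity)]
  rcases hx with h | h <;> rw [h] <;> ring

theorem stereoVec_eq_base {d : ℕ} {x : Fin (d + 1) → ℝ} (hm : ∃ i, x i = 0) :
    stereoVec x 0 = EuclideanSpace.single 0 1 := by
  have hpos := stereoVec_denominator_pos hm
  ext i
  refine Fin.cases ?_ (fun i => ?_) i
  · simp only [stereoVec, Fin.cons_zero, PiLp.single_apply, if_true]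
    rw [div_eq_one_iff_eq hpos.ne']
    ring
  · simp [stereoVec]

theorem stereoVec_ne_base {d : ℕ} {x : Fin (d + 1) → ℝ} {m : ℝ} (hm : ∃ i, x i = m) (h0 : m ≠ 0) :
    stereoVec x m ≠ EuclideanSpace.single 0 1 := by
  intro h
  have hpos := stereoVec_denominator_pos hm
  have h1 := congrArg (fun v : EuclideanSpace ℝ (Fin (d + 1)) => v 0) h
  simp only [stereoVec, Fin.cons_zero, PiLp.single_apply, if_true] at h1
  rw [div_eq_one_iff_eq hpos.ne'] at h1
  have := pow_pos (abs_pos.2 h0) 2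
  rw [sq_abs] at this
  linarith

/-- In the open simplex, the ratios `(x (i + 1) - x 0) / m` determine the point: they determine it up
to a positive factor, and the coordinates add up to `1`. -/
theorem eq_of_stereoVec_eq {d : ℕ} {x x' : Fin (d + 1) → ℝ} {m m' : ℝ} (hm : ∃ i, x i = m)
    (hm' : ∃ i, x' i = m') (hle : ∀ i, m ≤ x i) (hle' : ∀ i, m' ≤ x' i) (hpos : 0 < m)
    (hpos' : 0 < m') (hx : ∑ i, x i = 1) (hx' : ∑ i, x' i = 1)
    (h : stereoVec x m = stereoVec x' m') : x = x' := by
  have hn := stereoVec_denominator_pos hm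
  have hn' := stereoVec_denominator_pos hm'
  have h0 := congrArg (fun v : EuclideanSpace ℝ (Fin (d + 1)) => v 0) h
  have hs : ∀ i : Fin d, _ := fun i =>
    congrArg (fun v : EuclideanSpace ℝ (Fin (d + 1)) => v i.succ) h
  simp only [stereoVec, Fin.cons_zero, Fin.cons_succ] at h0 hs
  set n := (∑ i : Fin d, (x i.succ - x 0) ^ 2) + (1 - ∑ i, x i) ^ 2 + m ^ 2 with hndef
  set n' := (∑ i : Fin d, (x' i.succ - x' 0) ^ 2) + (1 - ∑ i, x' i) ^ 2 + m' ^ 2 with hndef'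
  have e0 : m ^ 2 / n = m' ^ 2 / n' := by
    have a : ((∑ i : Fin d, (x i.succ - x 0) ^ 2) + (1 - ∑ i, x i) ^ 2 - m ^ 2) / n =
        1 - 2 * (m ^ 2 / n) := by
      rw [hndef]
      field_simp
      ring
    have a' : ((∑ i : Fin d, (x' i.succ - x' 0) ^ 2) + (1 - ∑ i, x' i) ^ 2 - m' ^ 2) / n' =
        1 - 2 * (m' ^ 2 / n') := by
      rw [hndef']
      field_simp
      ring
    rw [a, a'] at h0
    linarith
  -- `x' i - x' 0 = (m' / m) * (x i - x 0)` for all `i`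
  have hprop : ∀ i, (x' i - x' 0) * m = m' * (x i - x 0) := by
    intro i
    refine Fin.cases (by simp) (fun i => ?_) i
    have h1 : (x i.succ - x 0) / m * (m ^ 2 / n) = (x' i.succ - x' 0) / m' * (m' ^ 2 / n') := by
      have := hs i
      have b : (x i.succ - x 0) / m * (m ^ 2 / n) = 2 * m * (x i.succ - x 0) / n / 2 := by
        field_simp
      have b' : (x' i.succ - x' 0) / m' * (m' ^ 2 / n') =
          2 * m' * (x' i.succ - x' 0) / n' / 2 := by
        field_simp
      rw [b, b', this]
    rw [← e0] at h1
    have h2 := mul_right_cancel₀ (by positivity) h1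
    field_simp at h2
    linarith
  have h00 : x' 0 * m = m' * x 0 := by
    obtain ⟨i, hi⟩ := hm
    obtain ⟨j, hj⟩ := hm'
    have h1 := hprop i
    have h2 := hprop j
    have h3 := mul_le_mul_of_nonneg_right (hle' i) hpos.le
    have h4 := mul_le_mul_of_nonneg_left (hle j) hpos'.le
    rw [hi] at h1
    rw [hj] at h2
    nlinarith
  have hall : ∀ i, x' i * m = m' * x i := fun i => by linarith [hprop i]
  have hmm : m = m' := by
    have := Finset.sum_congr rfl fun i (_ : i ∈ Finset.univ) => hall i
    rw [← Finset.sum_mul, ← Finset.mul_sum, hx, hx'] at this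
    linarith
  funext i
  have := hall i
  rw [← hmm, mul_comm] at this
  exact (mul_left_cancel₀ hpos.ne' this).symm

/-- The inverse of the map of the open simplex to the sphere without its base point. -/
theorem exists_stereoVec_eq {d : ℕ} {z : EuclideanSpace ℝ (Fin (d + 1))} (hz : ‖z‖ = 1)
    (hne : z ≠ EuclideanSpace.single 0 1) :
    ∃ (x : Fin (d + 1) → ℝ) (m : ℝ), 0 < m ∧ (∃ i, x i = m) ∧ (∀ i, m ≤ x i) ∧ ∑ i, x i = 1 ∧
      stereoVec x m = z := by
  have hz1 : z 0 ^ 2 + ∑ i : Fin d, z i.succ ^ 2 = 1 := by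
    rw [EuclideanSpace.norm_eq, Real.sqrt_eq_one, Fin.sum_univ_succ] at hz
    simpa using hz
  have hnn : 0 ≤ ∑ i : Fin d, z i.succ ^ 2 := Finset.sum_nonneg fun i _ => sq_nonneg _
  have hz0 : z 0 < 1 := by
    refine lt_of_le_of_ne (by nlinarith) fun h => hne ?_
    rw [h] at hz1
    have e1 : ∑ i : Fin d, z i.succ ^ 2 = 0 := by linarith
    ext i
    refine Fin.cases ?_ (fun i => ?_) i
    · simpa using h
    · have := (Finset.sum_eq_zero_iff_of_nonneg fun i _ => sq_nonneg _).1 e1 i (Finset.mem_univ _)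
      simpa using this
  -- the stereographic projection `p` of `z`, with an additional coordinate `0` in front
  let p : Fin (d + 1) → ℝ := Fin.cons 0 fun i => z i.succ / (1 - z 0)
  obtain ⟨j, -, hj⟩ := Finset.exists_min_image Finset.univ p ⟨0, Finset.mem_univ _⟩
  let s : ℝ := ∑ i, (1 + p i - p j)
  have hs : 0 < s := Finset.sum_pos (fun i _ => by linarith [hj i (Finset.mem_univ _)])
    ⟨0, Finset.mem_univ _⟩
  refine ⟨fun i => (1 + p i - p j) / s, 1 / s, by positivity, ⟨j, by simp⟩, fun i => ?_, ?_, ?_⟩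
  · refine div_le_div_of_nonneg_right ?_ hs.le
    linarith [hj i (Finset.mem_univ _)]
  · rw [← Finset.sum_div]
    exact div_self hs.ne'
  have hsum : ∑ i, (1 + p i - p j) / s = 1 := by
    rw [← Finset.sum_div]
    exact div_self hs.ne'
  have hy : ∀ i : Fin d, (1 + p i.succ - p j) / s - (1 + p 0 - p j) / s =
      z i.succ / (1 - z 0) / s := by
    intro i
    simp only [p, Fin.cons_zero, Fin.cons_succ]
    ring
  have h1z : 0 < 1 - z 0 := by linarith
  have hysum : ∑ i : Fin d, (z i.succ / (1 - z 0) / s) ^ 2 = (1 + z 0) / (1 - z 0) / s ^ 2 := by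
    simp only [div_pow]
    rw [← Finset.sum_div, ← Finset.sum_div, show ∑ i : Fin d, z i.succ ^ 2 = 1 - z 0 ^ 2 by linarith]
    field_simp
    ring
  ext i
  refine Fin.cases ?_ (fun i => ?_) i
  · simp only [stereoVec, Fin.cons_zero, hy, hsum, hysum]
    field_simp
    ring
  · simp only [stereoVec, Fin.cons_succ, hy, hsum, hysum]
    field_simp
    ring

end Wedge

section FacetSphere

variable {V : Type*} {K F : Finset (Finset V)} {d : ℕ}

namespace IsFacetSet

/-- A complex from which some `d`-dimensional facets can be removed to leave a contractible
subcomplex is homotopy equivalent to a wedge of `d`-spheres, one for each of these facets. -/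
theorem nonempty_homotopyEquiv_wedge [DecidableEq V] (h : IsFacetSet K F d)
    [hc : ContractibleSpace (realize ((K \ F : Finset (Finset V)) : Set (Finset V)))] :
    Nonempty (ContinuousMap.HomotopyEquiv (realize (K : Set (Finset V)))
      (WedgeOfSpheres F.card d)) := by
  have hsubK : realize ((K \ F : Finset (Finset V)) : Set (Finset V)) ⊆
      realize (K : Set (Finset V)) :=
    realize_mono (Finset.coe_subset.2 Finset.sdiff_subset)
  obtain ⟨G, a₀, hG0, hGA, hG1⟩ := h.exists_homotopy_extension
  -- `g i` is the `i`-th facet in `F`, and `e i` enumerates its vertices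
  let g : Fin F.card → Finset V := fun i => F.equivFin.symm i
  have hgF : ∀ i, g i ∈ F := fun i => (F.equivFin.symm i).2
  have hginj : ∀ i j, g i = g j → i = j := fun i j hij =>
    F.equivFin.symm.injective (Subtype.ext hij)
  have hgsurj : ∀ f ∈ F, ∃ i, g i = f := fun f hf => ⟨F.equivFin ⟨f, hf⟩, by simp [g]⟩
  let ε : ∀ i, Fin (d + 1) ≃ g i := fun i => ((g i).equivFinOfCardEq (h.card_eq _ (hgF i))).symm
  let e : ∀ i, Fin (d + 1) → V := fun i j => ε i j
  have hsum : ∀ i (w : V → ℝ), ∑ j, w (e i j) = ∑ v ∈ g i, w v := by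
    intro i w
    rw [← Finset.sum_coe_sort (g i) w]
    exact (ε i).sum_comp fun v => w v
  have hmin : ∀ i (w : V → ℝ), ∃ j, w (e i j) = minCoord (g i) w := by
    intro i w
    obtain ⟨v, hv, hw⟩ := exists_eq_minCoord (h.nonempty_of_mem (hgF i)) w
    exact ⟨(ε i).symm ⟨v, hv⟩, by simpa [e] using hw⟩
  have hmle : ∀ i (w : V → ℝ) j, minCoord (g i) w ≤ w (e i j) := fun i w j =>
    minCoord_le (ε i j).2 w
  let φ : ∀ i, realize (K : Set (Finset V)) → UnitSphere d := fun i w =>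
    ⟨stereoVec (fun j => (w : V → ℝ) (e i j)) (minCoord (g i) w), by
      refine stereoVec_mem_sphere (hmin i w) ?_
      rcases (minCoord_nonneg w.2 (f := g i)).eq_or_lt with h0 | h0
      · exact Or.inl h0.symm
      · exact Or.inr ((hsum i w).trans (h.supported_of_minCoord_pos (hgF i) w.2 h0).2.2)⟩
  have hφcont : ∀ i, Continuous (φ i) := by
    intro i
    refine Continuous.subtype_mk (continuous_stereoVec
      (x := fun (w : realize (K : Set (Finset V))) j => (w : V → ℝ) (e i j))
      (continuous_pi fun j => ?_) ?_ fun w => hmin i w) _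
    · exact (continuous_apply _).comp continuous_subtype_val
    · exact (continuous_minCoord _).comp continuous_subtype_val
  have hφbase : ∀ i (w : realize (K : Set (Finset V))),
      φ i w = UnitSphere.base d ↔ minCoord (g i) (w : V → ℝ) = 0 := by
    intro i w
    have hval : φ i w = UnitSphere.base d ↔
        stereoVec (fun j => (w : V → ℝ) (e i j)) (minCoord (g i) w) =
          EuclideanSpace.single 0 1 := Subtype.ext_iff
    rw [hval]
    refine ⟨fun hb => ?_, fun h0 => ?_⟩
    · by_contra hne
      exact stereoVec_ne_base (hmin i w) hne hb
    · obtain ⟨j, hj⟩ := hmin i w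
      rw [h0] at hj ⊢
      exact stereoVec_eq_base ⟨j, hj⟩
  have hφne : ∀ i j (w : realize (K : Set (Finset V))), φ i w ≠ UnitSphere.base d → j ≠ i →
      φ j w = UnitSphere.base d := by
    intro i j w hw hji
    refine (hφbase j w).2 (h.minCoord_eq_zero_of_ne (hgF i) (hgF j) (fun e => hji (hginj _ _ e))
      w.2 ?_)
    exact lt_of_le_of_ne (minCoord_nonneg w.2) fun h0 => hw ((hφbase i w).2 h0.symm)
  have hφA : ∀ w : realize (K : Set (Finset V)),
      (w : V → ℝ) ∈ realize ((K \ F : Finset (Finset V)) : Set (Finset V)) ↔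
        ∀ i, φ i w = UnitSphere.base d := by
    intro w
    rw [h.mem_realize_sdiff_iff w.2]
    refine ⟨fun hw i => (hφbase i w).2 (hw _ (hgF i)), fun hw f hf => ?_⟩
    obtain ⟨i, rfl⟩ := hgsurj f hf
    exact (hφbase i w).1 (hw i)
  have hφinj : ∀ i (w w' : realize (K : Set (Finset V))), φ i w ≠ UnitSphere.base d →
      φ i w = φ i w' → w = w' := by
    intro i w w' hne heq
    have hpos : ∀ w : realize (K : Set (Finset V)), φ i w ≠ UnitSphere.base d →
        0 < minCoord (g i) (w : V → ℝ) := fun w hw =>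
      lt_of_le_of_ne (minCoord_nonneg w.2) fun h0 => hw ((hφbase i w).2 h0.symm)
    have hw := h.supported_of_minCoord_pos (hgF i) w.2 (hpos w hne)
    have hw' := h.supported_of_minCoord_pos (hgF i) w'.2 (hpos w' (heq ▸ hne))
    have hx := eq_of_stereoVec_eq (hmin i w) (hmin i w') (hmle i w) (hmle i w') (hpos w hne)
      (hpos w' (heq ▸ hne)) ((hsum i w).trans hw.2.2) ((hsum i w').trans hw'.2.2)
      (congrArg Subtype.val heq)
    refine Subtype.ext (funext fun v => ?_)
    by_cases hv : v ∈ g i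
    · have := congrFun hx ((ε i).symm ⟨v, hv⟩)
      simpa [e] using this
    · rw [hw.2.1 v hv, hw'.2.1 v hv]
  have hφsurj : ∀ i (z : UnitSphere d), z ≠ UnitSphere.base d → ∃ w, φ i w = z := by
    intro i z hz
    obtain ⟨x, m, hm, hex, hle, hx, hxz⟩ := exists_stereoVec_eq
      (mem_sphere_zero_iff_norm.1 z.2) fun e => hz (Subtype.ext e)
    let w : V → ℝ := fun v => if hv : v ∈ g i then x ((ε i).symm ⟨v, hv⟩) else 0
    have hwe : ∀ j, w (e i j) = x j := fun j => by simp [w, e]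
    have hmw : minCoord (g i) w = m := by
      obtain ⟨j, hj⟩ := hmin i w
      obtain ⟨j', hj'⟩ := hex
      refine le_antisymm ?_ ?_
      · rw [← hj', ← hwe j']
        exact hmle i w j'
      · rw [← hj, hwe j]
        exact hle j
    refine ⟨⟨w, g i, Finset.mem_coe.2 (h.subset (hgF i)), fun v => ?_, fun v hv => dif_neg hv, ?_⟩,
      Subtype.ext ?_⟩
    · by_cases hv : v ∈ g i
      · simp only [w, dif_pos hv]
        exact hm.le.trans (hle _)
      · simp [w, hv]
    · rw [← hsum i w]
      simpa only [hwe] using hx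
    · change stereoVec (fun j => w (e i j)) (minCoord (g i) w) = z
      rw [hmw]
      simpa only [hwe] using hxz
  -- the quotient map, obtained by lifting `φ` along the embedding of the wedge into the product
  have hlift : ∀ w : realize (K : Set (Finset V)), ∃ z, wedgeToPi F.card d z = fun i => φ i w := by
    intro w
    by_cases hw : ∃ i, φ i w ≠ UnitSphere.base d
    · obtain ⟨i, hi⟩ := hw
      refine ⟨Quot.mk _ (Sum.inr ⟨i, φ i w⟩), funext fun j => ?_⟩
      by_cases hji : j = i
      · subst hji
        simp [wedgeToPi]
      · simp [wedgeToPi, hji, hφne i j w hi hji]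
    · push Not at hw
      exact ⟨Quot.mk _ (Sum.inl ()), funext fun j => (hw j).symm⟩
  choose q hq using hlift
  have hemb := isClosedEmbedding_wedgeToPi F.card d
  have hqcont : Continuous q := by
    refine hemb.isInducing.continuous_iff.2 ?_
    rw [show wedgeToPi F.card d ∘ q = fun w i => φ i w from funext hq]
    exact continuous_pi hφcont
  have hqsurj : Function.Surjective q := by
    obtain ⟨⟨c, hcA⟩⟩ := (inferInstance :
      Nonempty (realize ((K \ F : Finset (Finset V)) : Set (Finset V))))
    have hbase : ∃ w, q w = Quot.mk _ (Sum.inl ()) := by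
      refine ⟨⟨c, hsubK hcA⟩, hemb.injective ((hq _).trans (funext fun i => ?_))⟩
      exact (hφA ⟨c, hsubK hcA⟩).1 hcA i
    rintro ⟨⟨⟩ | ⟨i, z⟩⟩
    · exact hbase
    · by_cases hz : z = UnitSphere.base d
      · subst hz
        obtain ⟨w, hw⟩ := hbase
        exact ⟨w, hw.trans (Quot.sound (WedgeRel.glue i))⟩
      · obtain ⟨w, rfl⟩ := hφsurj i z hz
        refine ⟨w, hemb.injective ((hq _).trans (funext fun j => ?_))⟩
        by_cases hji : j = i
        · subst hji
          simp [wedgeToPi]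
        · simp [wedgeToPi, hji, hφne i j w hz hji]
  have : CompactSpace (realize (K : Set (Finset V))) :=
    isCompact_iff_compactSpace.1 (isCompact_realize K)
  have : T2Space (WedgeOfSpheres F.card d) := hemb.isEmbedding.t2Space
  have hquot : Topology.IsQuotientMap q := hqcont.isClosedMap.isQuotientMap hqcont hqsurj
  refine nonempty_homotopyEquiv_of_isQuotientMap
    (A := {w | (w : V → ℝ) ∈ realize ((K \ F : Finset (Finset V)) : Set (Finset V))})
    G hG0 hGA hG1 hquot ?_ ?_
  · intro w hw w' hw'
    refine hemb.injective ((hq w).trans (Eq.trans (funext fun i => ?_) (hq w').symm))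
    rw [(hφA w).1 hw i, (hφA w').1 hw' i]
  · intro w w' heq
    have hφeq : ∀ i, φ i w = φ i w' := fun i => by
      have := (hq w).symm.trans ((congrArg _ heq).trans (hq w'))
      exact congrFun this i
    by_cases hw : ∃ i, φ i w ≠ UnitSphere.base d
    · obtain ⟨i, hi⟩ := hw
      exact Or.inl (hφinj i w w' hi (hφeq i))
    · push Not at hw
      exact Or.inr ⟨(hφA w).2 hw, (hφA w').2 fun i => (hφeq i).symm.trans (hw i)⟩

end IsFacetSet

theorem IsSpherical.exists_homotopyEquiv_wedge [DecidableEq V]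
    (hK : IsLowerSet (K : Set (Finset V))) (hne : K.Nonempty) (h : IsSpherical K (d + 1)) :
    ∃ k : ℕ, Nonempty (ContinuousMap.HomotopyEquiv (realize (K : Set (Finset V)))
      (WedgeOfSpheres k d)) := by
  obtain ⟨hcard, F, hFK, hF, hcol⟩ := h
  have hfacets : IsFacetSet K F d := ⟨hK, hFK, hcard, hF⟩
  have hlow : IsLowerSet ((K \ F : Finset (Finset V)) : Set (Finset V)) := by
    intro s t hts hs
    rw [Finset.mem_coe, Finset.mem_sdiff] at hs ⊢
    refine ⟨hK hts hs.1, fun ht => hs.2 ?_⟩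
    exact hfacets.eq_of_subset ht hs.1 hts ▸ ht
  have hempty : ∅ ∈ K \ F := by
    obtain ⟨s, hs⟩ := hne
    refine Finset.mem_sdiff.2 ⟨hK (Finset.empty_subset s) hs, fun h0 => ?_⟩
    have := hF _ h0
    simp at this
  have := hcol.contractibleSpace hlow ⟨_, hempty⟩
  exact ⟨F.card, hfacets.nonempty_homotopyEquiv_wedge⟩

end FacetSphere

theorem mainTheorem5 {C R : Type*} [DecidableEq C] [DecidableEq R] (n m : ℕ)
    (hn : 1 ≤ n) (hnm : n ≤ m) (X Z : Finset C) (Y : Finset R)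
    (hX : X.card = n) (hY : Y.card = n) (hZ : Z.card = m) (hXZ : Disjoint X Z)
    (α : {y // y ∈ Y} ≃ {x // x ∈ X}) :
    ∃ k : ℕ, Nonempty (ContinuousMap.HomotopyEquiv
      (geometricRealization (cycleFreeComplex X Z Y ∅ α)) (WedgeOfSpheres k (n - 1))) := by
  have hreal : geometricRealization (cycleFreeComplex X Z Y ∅ α) =
      realize (rookLink (columnLabel α) ∅ ((X ∪ Z) ×ˢ Y) : Set (Finset (C × R))) := by
    rw [← realize_inter_nonempty]
    exact congrArg realize (Set.ext fun S => mem_faces_cycleFreeComplex)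
  have hsph := isSpherical_cycleFree (α := α) hXZ (hX.trans hY.symm) (by omega)
  rw [hY, show n = n - 1 + 1 by omega] at hsph
  rw [hreal]
  refine hsph.exists_homotopyEquiv_wedge ?_ ⟨∅, ?_⟩
  · intro S T hTS hS
    rw [Finset.mem_coe, mem_rookLink] at hS ⊢
    exact ⟨hTS.trans hS.1, hS.2.mono (Finset.union_subset_union_right hTS)⟩
  · rw [mem_rookLink, Finset.union_empty]
    exact ⟨Finset.empty_subset _, isAdmissible_empty⟩
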